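/- Let $k$ be a field and let $A=\bigoplus_{i\ge 0}A_i$ be a commutative, standard graded, finitely generated $k$-algebra ($A_0=k$, $V:=A_1$ finite-dimensional, $A_i=(A_1)^i$) that is Koszul, i.e. the residue field $k=A/A_+$ has a linear minimal graded free resolution over $A$. Let $x_1,\dots,x_n$ be a basis of $V$ and $x_1^*,\dots,x_n^*$ the dual basis of $V^*=\operatorname{Hom}_k(V,k)$. Let $Q_2=\ker(V\otimes_k V\to A_2)$ and let $A^!=T(V^*)/(Q_2^{\perp})$ be the quadratic dual, where $Q_2^\perp\subseteq V^*\otimes V^*$ is the orthogonal complement of $Q_2$ for the pairing $\langle v_1\otimes v_2,u_1\otimes u_2\rangle=u_1(v_1)u_2(v_2)$. The Priddy complex of $A$ has terms $A\otimes_k(A^!_i)^*$ and differential $a\otimes\varphi\mapsto\sum_j a x_j\otimes\varphi\cdot x_j^*$, where $(\varphi\cdot \xi)(b)=\varphi(\xi b)$. Let $\ell_1,\dots,\ell_r\in A_1$ be linear forms, let $L\subseteq A^!$ be the left ideal generated by all $\xi\in V^*$ with $\xi(\ell_1)=\dots=\xi(\ell_r)=0$ (if $\{\ell_1,\dots,\ell_r\}=\{x_i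 : i\in E\}$, then $L=\sum_{i\notin E}A^!x_i^*$), and put $B=A^!/L$, a graded left $A^!$-module with components $B_i$. Consider the complex $$A\otimes B^*_\bullet:\qquad \cdots\to A\otimes_k B_2^*\to A\otimes_k B_1^*\to A\otimes_k B_0^*=A\to 0,$$ with differential $a\otimes\varphi\mapsto\sum_j a x_j\otimes\varphi\cdot x_j^*$ and $A_m\otimes B_i^*$ placed in internal degree $m+i$. For a minimal graded free complex $F_\bullet$ and $d\in\mathbb{N}$ (the initial degree of $F_0$ if $F_0\ne 0$), the linear strand of $F_\bullet$ is the subcomplex generated by the components $(F_i)_{d+i}$. Then: 1. The maps $A\otimes B_i^*\to A\otimes (A^!_i)^*$ dual to the projection $A^!\to B$ are injective, preserve the internal degree and commute with the differentials, so $A\otimes B^*_\bullet$ is a subcomplex of the Priddy complex. 2. $A\otimes B^*_\bullet$ is isomorphic, as a complex of graded $A$-modules, to the linear strand (with $d=0$) of every minimal graded free resolution of $A/(\ell_1,\dots,\ell_r)$; and its part $\cdots\to A\otimes B_2^*\to A\otimes B_1^*$, with $A\otimes B_1^*$ in homological degree $0$, is isomorphic to the linear strand (with $d=1$) of every minimal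 graded free resolution of the ideal $(\ell_1,\dots,\ell_r)$. 3. If $A$ is universally Koszul, i.e. $A$ is Koszul and every ideal of $A$ generated by linear forms has a linear resolution, then $A\otimes B^*_\bullet$, with the augmentation $A\otimes B^*_0\to A/(\ell_1,\dots,\ell_r)$, $a\otimes\varphi\mapsto\varphi(1)\,\overline{a}$, is a minimal graded free resolution of $A/(\ell_1,\dots,\ell_r)$. -/

import Mathlib

universe u

noncomputable section

open scoped TensorProduct

namespace KoszulStrand

variable {k A : Type u} [Field k] [CommRing A] [Algebra k A]

/-! ### Standard graded algebras, graded complexes and minimal free resolutions -/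

/-- `A` is standard graded: the component of degree `m` is spanned by the products of `m` elements
of degree one. In particular `A₀ = k · 1` and `A` is generated by `A₁` as a `k`-algebra. -/
def IsStandardGraded (𝒜 : ℕ → Submodule k A) : Prop :=
  ∀ m, 𝒜 m = 𝒜 1 ^ m

/-- A complex `⋯ → X 2 → X 1 → X 0` of `A`-modules with specified homogeneous components
`gr i n ⊆ X i`, which the differential respects. -/
structure GradedComplex (A : Type u) [CommRing A] where
  /-- the modules -/
  X : ℕ → Type u
  /-- their additive structure -/
  [addCommGroup : ∀ i, AddCommGroup (X i)]
  /-- their module structure -/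
  [module : ∀ i, Module A (X i)]
  /-- the differential -/
  d : ∀ i, X (i + 1) →ₗ[A] X i
  d_comp_d : ∀ i, d i ∘ₗ d (i + 1) = 0
  /-- the component of internal degree `n` in homological degree `i` -/
  gr : ∀ i, ℕ → AddSubgroup (X i)
  d_mem : ∀ i n y, y ∈ gr (i + 1) n → d i y ∈ gr i n

attribute [instance] GradedComplex.addCommGroup GradedComplex.module

namespace GradedComplex

/-- Isomorphisms of complexes of `A`-modules which preserve the internal degree. -/
structure GradedIso (F G : GradedComplex A) where
  /-- the isomorphism in each homological degree -/
  e : ∀ i, F.X i ≃ₗ[A] G.X i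
  comm : ∀ i y, e i (F.d i y) = G.d i (e (i + 1) y)
  mem_iff : ∀ i n y, e i y ∈ G.gr i n ↔ y ∈ F.gr i n

/-- The complex `⋯ → X 2 → X 1` with `X 1` placed in homological degree zero. -/
def tail (F : GradedComplex A) : GradedComplex A where
  X i := F.X (i + 1)
  d i := F.d (i + 1)
  d_comp_d i := F.d_comp_d (i + 1)
  gr i := F.gr (i + 1)
  d_mem i := F.d_mem (i + 1)

variable (𝒜 : ℕ → Submodule k A)

/-- Every term is a graded free module of finite rank: it has a finite basis `b` and degrees `deg`
that identify it, together with its components, with `⨁ₛ A(-deg s)`. -/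
def IsGradedFree (F : GradedComplex A) : Prop :=
  ∀ i, ∃ (r : ℕ) (b : Module.Basis (Fin r) A (F.X i)) (deg : Fin r → ℕ),
    ∀ n y, y ∈ F.gr i n ↔
      ∀ s, b.repr y s = 0 ∨ ∃ m, deg s + m = n ∧ b.repr y s ∈ 𝒜 m

variable [GradedAlgebra 𝒜]

/-- The differential maps into `A₊ F`, where `A₊` is the ideal of elements of positive degree. -/
def IsMinimal (F : GradedComplex A) : Prop :=
  ∀ i, LinearMap.range (F.d i) ≤
    (HomogeneousIdeal.irrelevant 𝒜).toIdeal • (⊤ : Submodule A (F.X i))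

variable {𝒜} in
/-- In a minimal graded free complex over a standard graded algebra, the differential maps the
submodule generated by the elements of degree `d + i + 1` into the one generated by the elements of
degree `d + i`. -/
theorem d_mem_span (hA : IsStandardGraded 𝒜) {F : GradedComplex A} (hF : F.IsGradedFree 𝒜)
    (hmin : F.IsMinimal 𝒜) (d i : ℕ) (y : F.X (i + 1))
    (hy : y ∈ Submodule.span A (F.gr (i + 1) (d + (i + 1)) : Set (F.X (i + 1)))) :
    F.d i y ∈ Submodule.span A (F.gr i (d + i) : Set (F.X i)) := by
  suffices h : Submodule.span A (F.gr (i + 1) (d + (i + 1)) : Set (F.X (i + 1))) ≤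
      (Submodule.span A (F.gr i (d + i) : Set (F.X i))).comap (F.d i) from h hy
  rw [Submodule.span_le]
  intro z hz
  obtain ⟨r, b, deg, hb⟩ := hF i
  have h1 : F.d i z ∈ F.gr i (d + (i + 1)) := F.d_mem _ _ _ hz
  have h2 : ∀ s, b.repr (F.d i z) s ∈ (HomogeneousIdeal.irrelevant 𝒜).toIdeal := by
    have h0 : F.d i z ∈ (HomogeneousIdeal.irrelevant 𝒜).toIdeal •
        (⊤ : Submodule A (F.X i)) := hmin i (LinearMap.mem_range_self _ z)
    intro s
    have h3 : (HomogeneousIdeal.irrelevant 𝒜).toIdeal • (⊤ : Submodule A (F.X i)) ≤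
        Submodule.comap (b.coord s) (HomogeneousIdeal.irrelevant 𝒜).toIdeal := by
      rw [Submodule.smul_le]
      intro a ha w _
      rw [Submodule.mem_comap, map_smul, smul_eq_mul]
      exact Ideal.mul_mem_right _ _ ha
    exact h3 h0
  change F.d i z ∈ Submodule.span A (F.gr i (d + i) : Set (F.X i))
  rw [← b.sum_repr (F.d i z)]
  refine Submodule.sum_mem _ fun s _ => ?_
  rcases (hb _ _).1 h1 s with h0 | ⟨m, hm, hc⟩
  · simp [h0]
  · cases m with
    | zero =>
      have h4 := (HomogeneousIdeal.mem_irrelevant_iff 𝒜 _).1 (h2 s)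
      rw [GradedRing.proj_apply, DirectSum.decompose_of_mem_same 𝒜 hc] at h4
      simp [h4]
    | succ m =>
      rw [hA, pow_succ', ← hA m] at hc
      have hbs : ∀ c ∈ 𝒜 m, c • b s ∈ F.gr i (d + i) := by
        intro c hc
        rw [hb]
        intro t
        by_cases hst : s = t
        · subst hst
          right
          exact ⟨m, by omega, by simpa using hc⟩
        · left
          simp [hst]
      refine Submodule.mul_induction_on hc ?_ ?_
      · intro a _ c hc
        rw [mul_smul]
        exact Submodule.smul_mem _ _ (Submodule.subset_span (hbs c hc))
      · intro a c ha hc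
        rw [add_smul]
        exact Submodule.add_mem _ ha hc

variable {𝒜} in
/-- The linear strand of a minimal graded free complex `F` with `F₀` of initial degree `d`: the
subcomplex of `F` generated by the components `(Fᵢ)_{d+i}`. -/
def linearStrand (hA : IsStandardGraded 𝒜) (F : GradedComplex A) (hF : F.IsGradedFree 𝒜)
    (hmin : F.IsMinimal 𝒜) (d : ℕ) : GradedComplex A where
  X i := ↥(Submodule.span A (F.gr i (d + i) : Set (F.X i)))
  d i := (F.d i).restrict (d_mem_span hA hF hmin d i)
  d_comp_d i := by
    ext y
    exact LinearMap.congr_fun (F.d_comp_d i) (y : F.X (i + 2))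
  gr i n := (F.gr i n).comap
    (Submodule.span A (F.gr i (d + i) : Set (F.X i))).subtype.toAddMonoidHom
  d_mem i n y hy := F.d_mem i n y hy

/-- `F`, with augmentation `ε : F₀ → M`, is a minimal graded free resolution of the module `M` with
homogeneous components `ℳ n`. -/
structure IsMinimalFreeResolution {M : Type u} [AddCommGroup M] [Module A M]
    (ℳ : ℕ → AddSubgroup M) (F : GradedComplex A) (ε : F.X 0 →ₗ[A] M) : Prop where
  free : F.IsGradedFree 𝒜
  minimal : F.IsMinimal 𝒜
  graded : ∀ n y, y ∈ F.gr 0 n → ε y ∈ ℳ n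
  surjective : Function.Surjective ε
  exact_zero : Function.Exact (F.d 0) ε
  exact_succ : ∀ i, Function.Exact (F.d (i + 1)) (F.d i)

end GradedComplex

section Koszul

variable (𝒜 : ℕ → Submodule k A)

/-- The homogeneous components of `A ⧸ J`. -/
def quotientGrading (J : Ideal A) (n : ℕ) : AddSubgroup (A ⧸ J) :=
  (𝒜 n).toAddSubgroup.map (Submodule.mkQ J).toAddMonoidHom

/-- The homogeneous components of an ideal `J`. -/
def idealGrading (J : Ideal A) (n : ℕ) : AddSubgroup J :=
  (𝒜 n).toAddSubgroup.comap (Submodule.subtype J).toAddMonoidHom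

variable [GradedAlgebra 𝒜]

/-- `M` has a `d`-linear minimal graded free resolution: `Fᵢ` is generated in degree `d + i`. -/
def HasLinearResolution {M : Type u} [AddCommGroup M] [Module A M] (ℳ : ℕ → AddSubgroup M)
    (d : ℕ) : Prop :=
  ∃ (F : GradedComplex A) (ε : F.X 0 →ₗ[A] M), F.IsMinimalFreeResolution 𝒜 ℳ ε ∧
    ∀ i, Submodule.span A (F.gr i (d + i) : Set (F.X i)) = ⊤

/-- `A` is Koszul: the residue field `A / A₊` has a linear minimal graded free resolution. -/
def IsKoszul : Prop :=
  HasLinearResolution 𝒜 (quotientGrading 𝒜 (HomogeneousIdeal.irrelevant 𝒜).toIdeal) 0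

/-- `A` is universally Koszul: it is Koszul, and every ideal generated by linear forms has a linear
resolution. -/
def IsUniversallyKoszul : Prop :=
  IsKoszul 𝒜 ∧ ∀ S : Set A, S ⊆ 𝒜 1 →
    HasLinearResolution 𝒜 (idealGrading 𝒜 (Ideal.span S)) 1

end Koszul

/-! ### The quadratic dual -/

section QuadraticDual

variable (𝒜 : ℕ → Submodule k A)

/-- The multiplication `V ⊗ V → A`, where `V = A₁`. -/
def mulTwo : (𝒜 1) ⊗[k] (𝒜 1) →ₗ[k] A :=
  LinearMap.mul' k A ∘ₗ TensorProduct.map (𝒜 1).subtype (𝒜 1).subtype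

/-- The orthogonal complement, in `V* ⊗ V*`, of the space `Q₂ = ker (V ⊗ V → A)` of quadratic
relations of `A`, for the pairing `⟨v₁ ⊗ v₂, u₁ ⊗ u₂⟩ = u₁ v₁ * u₂ v₂`. -/
def quadPerp : Submodule k (Module.Dual k (𝒜 1) ⊗[k] Module.Dual k (𝒜 1)) :=
  (LinearMap.ker (mulTwo 𝒜)).dualAnnihilator.comap (TensorProduct.dualDistrib k (𝒜 1) (𝒜 1))

/-- The inclusion of `V* ⊗ V*` into the tensor algebra of `V*`. -/
def tensorTwo : Module.Dual k (𝒜 1) ⊗[k] Module.Dual k (𝒜 1) →ₗ[k]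
    TensorAlgebra k (Module.Dual k (𝒜 1)) :=
  LinearMap.mul' k _ ∘ₗ TensorProduct.map (TensorAlgebra.ι k) (TensorAlgebra.ι k)

/-- The relations that define the quadratic dual. -/
inductive QuadraticDualRel :
    TensorAlgebra k (Module.Dual k (𝒜 1)) → TensorAlgebra k (Module.Dual k (𝒜 1)) → Prop
  | of (θ : Module.Dual k (𝒜 1) ⊗[k] Module.Dual k (𝒜 1)) (h : θ ∈ quadPerp 𝒜) :
      QuadraticDualRel (tensorTwo 𝒜 θ) 0

/-- The quadratic dual `A^! = T(V*) / (Q₂^⊥)`. -/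
abbrev QuadraticDual : Type u := RingQuot (QuadraticDualRel 𝒜)

/-- The map `V* → A^!`. -/
def dualGen : Module.Dual k (𝒜 1) →ₗ[k] QuadraticDual 𝒜 :=
  (RingQuot.mkAlgHom k (QuadraticDualRel 𝒜)).toLinearMap ∘ₗ TensorAlgebra.ι k

/-- The component of degree `i` of `A^!`, spanned by the products of `i` elements of `V*`. -/
def dualPiece (i : ℕ) : Submodule k (QuadraticDual 𝒜) :=
  LinearMap.range (dualGen 𝒜) ^ i

theorem dualGen_mul_mem (i : ℕ) (ξ : Module.Dual k (𝒜 1)) (a : QuadraticDual 𝒜)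
    (ha : a ∈ dualPiece 𝒜 i) : dualGen 𝒜 ξ • a ∈ dualPiece 𝒜 (i + 1) := by
  rw [dualPiece, pow_succ', smul_eq_mul]
  exact Submodule.mul_mem_mul ⟨ξ, rfl⟩ ha

end QuadraticDual

/-! ### The complex `A ⊗ M*` of a graded left module `M` over the quadratic dual -/

section DualComplex

variable (𝒜 : ℕ → Submodule k A)
variable {M : Type u} [AddCommGroup M] [Module k M] [Module (QuadraticDual 𝒜) M]
  [IsScalarTower k (QuadraticDual 𝒜) M] (N : ℕ → Submodule k M)
  (hN : ∀ i (ξ : Module.Dual k (𝒜 1)), ∀ m ∈ N i, dualGen 𝒜 ξ • m ∈ N (i + 1))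

/-- Left multiplication `Mᵢ → Mᵢ₊₁` by `ξ ∈ V*`. -/
def leftMul (i : ℕ) (ξ : Module.Dual k (𝒜 1)) : N i →ₗ[k] N (i + 1) :=
  (Algebra.lsmul k k M (dualGen 𝒜 ξ)).restrict (hN i ξ)

/-- The right action `φ ↦ φ · ξ` of `ξ ∈ V*` on the graded dual `M*`, with
`(φ · ξ) m = φ (ξ m)`. -/
def rightMul (i : ℕ) (ξ : Module.Dual k (𝒜 1)) :
    Module.Dual k (N (i + 1)) →ₗ[k] Module.Dual k (N i) :=
  (leftMul 𝒜 N hN i ξ).dualMap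

variable {n : ℕ} (x : Module.Basis (Fin n) k (𝒜 1))

/-- Multiplication by the trace element `∑ⱼ xⱼ ⊗ xⱼ*`: the map
`a ⊗ φ ↦ ∑ⱼ a xⱼ ⊗ φ · xⱼ*` from `A ⊗ Mᵢ₊₁*` to `A ⊗ Mᵢ*`. -/
def traceMul (i : ℕ) : A ⊗[k] Module.Dual k (N (i + 1)) →ₗ[A] A ⊗[k] Module.Dual k (N i) :=
  ∑ j, TensorProduct.AlgebraTensorModule.map (LinearMap.lsmul A A (x j : A))
    (rightMul 𝒜 N hN i (x.coord j))

theorem traceMul_tmul (i : ℕ) (a : A) (φ : Module.Dual k (N (i + 1))) :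
    traceMul 𝒜 N hN x i (a ⊗ₜ φ) =
      ∑ j, ((x j : A) * a) ⊗ₜ rightMul 𝒜 N hN i (x.coord j) φ := by
  simp [traceMul, LinearMap.sum_apply]

@[simp]
theorem coe_leftMul (i : ℕ) (ξ : Module.Dual k (𝒜 1)) (m : N i) :
    (leftMul 𝒜 N hN i ξ m : M) = dualGen 𝒜 ξ • (m : M) := rfl

theorem rightMul_apply (i : ℕ) (ξ : Module.Dual k (𝒜 1)) (φ : Module.Dual k (N (i + 1)))
    (m : N i) : rightMul 𝒜 N hN i ξ φ m = φ (leftMul 𝒜 N hN i ξ m) := rfl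

/-- The map `V* ⊗ V* → Mᵢ₊₂`, `ξ ⊗ η ↦ ξ (η m)`, for a fixed `m ∈ Mᵢ`. -/
def leftMulTwo (i : ℕ) (m : N i) :
    Module.Dual k (𝒜 1) ⊗[k] Module.Dual k (𝒜 1) →ₗ[k] N (i + 2) :=
  TensorProduct.lift (LinearMap.mk₂ k
    (fun ξ η => leftMul 𝒜 N hN (i + 1) ξ (leftMul 𝒜 N hN i η m))
    (fun _ _ _ => by ext; simp [add_smul])
    (fun _ _ _ => by ext; simp)
    (fun _ _ _ => by ext; simp [add_smul])
    (fun c ξ η => by ext; simp [smul_algebra_smul_comm]))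

theorem coe_leftMulTwo (i : ℕ) (m : N i)
    (θ : Module.Dual k (𝒜 1) ⊗[k] Module.Dual k (𝒜 1)) :
    (leftMulTwo 𝒜 N hN i m θ : M) =
      RingQuot.mkAlgHom k (QuadraticDualRel 𝒜) (tensorTwo 𝒜 θ) • (m : M) := by
  induction θ with
  | zero => simp
  | add a b ha hb => simp [ha, hb, add_smul]
  | tmul ξ η => simp [leftMulTwo, tensorTwo, dualGen, mul_smul]

theorem leftMulTwo_eq_zero (i : ℕ) (m : N i)
    (θ : Module.Dual k (𝒜 1) ⊗[k] Module.Dual k (𝒜 1)) (hθ : θ ∈ quadPerp 𝒜) :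
    leftMulTwo 𝒜 N hN i m θ = 0 := by
  ext
  rw [coe_leftMulTwo, RingQuot.mkAlgHom_rel k (QuadraticDualRel.of θ hθ)]
  simp

theorem trace_mem_quadPerp (α : A →ₗ[k] k) (a : A) :
    (∑ j, ∑ l, α ((x l : A) * ((x j : A) * a)) • (x.coord j ⊗ₜ[k] x.coord l)) ∈ quadPerp 𝒜 := by
  have key : TensorProduct.dualDistrib k (𝒜 1) (𝒜 1)
      (∑ j, ∑ l, α ((x l : A) * ((x j : A) * a)) • (x.coord j ⊗ₜ[k] x.coord l)) =
      α ∘ₗ LinearMap.mulRight k a ∘ₗ mulTwo 𝒜 := by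
    refine TensorProduct.ext (x.ext fun p => x.ext fun q => ?_)
    simp [mulTwo, LinearMap.sum_apply, Finsupp.single_apply, mul_left_comm, mul_assoc]
  rw [quadPerp, Submodule.mem_comap, key, Submodule.mem_dualAnnihilator]
  intro w hw
  simp [LinearMap.mem_ker.1 hw]

theorem traceMul_comp (i : ℕ) :
    traceMul 𝒜 N hN x i ∘ₗ traceMul 𝒜 N hN x (i + 1) = 0 := by
  classical
  refine TensorProduct.AlgebraTensorModule.ext fun a φ => ?_
  rw [LinearMap.comp_apply, traceMul_tmul, map_sum, LinearMap.zero_apply]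
  simp only [traceMul_tmul]
  let β := Module.Basis.ofVectorSpace k A
  apply (TensorProduct.equivFinsuppOfBasisLeft (N := Module.Dual k (N i)) β).injective
  rw [map_zero]
  ext p m
  have h := congrArg φ
    (leftMulTwo_eq_zero 𝒜 N hN i m _ (trace_mem_quadPerp 𝒜 x (β.coord p) a))
  simpa [leftMulTwo, rightMul_apply] using h

/-- The complex `⋯ → A ⊗ M₂* → A ⊗ M₁* → A ⊗ M₀*` with differential the multiplication by the trace
element. The elements `a ⊗ φ` with `a ∈ Aₘ` and `φ ∈ Mᵢ*` have degree `m + i`. -/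
def dualComplex [GradedAlgebra 𝒜] : GradedComplex A where
  X i := A ⊗[k] Module.Dual k (N i)
  d i := traceMul 𝒜 N hN x i
  d_comp_d i := traceMul_comp 𝒜 N hN x i
  gr i n := AddSubgroup.closure
    {z | ∃ m, m + i = n ∧ ∃ a ∈ 𝒜 m, ∃ φ : Module.Dual k (N i), z = a ⊗ₜ[k] φ}
  d_mem i n y hy := by
    induction hy using AddSubgroup.closure_induction with
    | zero => simp
    | add y z _ _ hy hz => rw [map_add]; exact add_mem hy hz
    | neg y _ hy => rw [map_neg]; exact neg_mem hy
    | mem y hy =>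
      obtain ⟨m, hm, a, ha, φ, rfl⟩ := hy
      rw [traceMul_tmul]
      refine sum_mem fun j _ => AddSubgroup.subset_closure
        ⟨1 + m, by omega, _, SetLike.mul_mem_graded (x j).2 ha, _, rfl⟩

end DualComplex

/-! ### The Priddy complex and its subcomplex attached to linear forms -/

section Priddy

variable (𝒜 : ℕ → Submodule k A)

/-- The left ideal `L` of `A^!` generated by the `ξ ∈ V*` that vanish on all `ℓ j`. If the `ℓ j` are
part of a basis of `V`, these are spanned by the dual basis vectors of the remaining members. -/
def leftIdeal {r : ℕ} (ℓ : Fin r → 𝒜 1) : Submodule (QuadraticDual 𝒜) (QuadraticDual 𝒜) :=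
  Submodule.span (QuadraticDual 𝒜) {a | ∃ ξ : Module.Dual k (𝒜 1), (∀ j, ξ (ℓ j) = 0) ∧
    a = dualGen 𝒜 ξ}

/-- The component of degree `i` of the left module `B = A^! / L`. -/
def bPiece {r : ℕ} (ℓ : Fin r → 𝒜 1) (i : ℕ) : Submodule k (QuadraticDual 𝒜 ⧸ leftIdeal 𝒜 ℓ) :=
  (dualPiece 𝒜 i).map ((leftIdeal 𝒜 ℓ).mkQ.restrictScalars k)

theorem dualGen_smul_mem_bPiece {r : ℕ} (ℓ : Fin r → 𝒜 1) (i : ℕ) (ξ : Module.Dual k (𝒜 1)) :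
    ∀ m ∈ bPiece 𝒜 ℓ i, dualGen 𝒜 ξ • m ∈ bPiece 𝒜 ℓ (i + 1) := by
  rintro _ ⟨a, ha, rfl⟩
  exact ⟨dualGen 𝒜 ξ • a, dualGen_mul_mem 𝒜 i ξ a ha, rfl⟩

variable [GradedAlgebra 𝒜] {n : ℕ} (x : Module.Basis (Fin n) k (𝒜 1))

/-- The Priddy complex, with terms `A ⊗ (A^!ᵢ)*`. -/
def priddyComplex : GradedComplex A :=
  dualComplex 𝒜 (dualPiece 𝒜) (dualGen_mul_mem 𝒜) x

/-- The complex with terms `A ⊗ Bᵢ*`, where `B = A^! / L`. -/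
def subPriddyComplex {r : ℕ} (ℓ : Fin r → 𝒜 1) : GradedComplex A :=
  dualComplex 𝒜 (bPiece 𝒜 ℓ) (dualGen_smul_mem_bPiece 𝒜 ℓ) x

/-- The map `A ⊗ Bᵢ* → A ⊗ (A^!ᵢ)*` induced by the projection `A^! → B`. -/
def subPriddyInclusion {r : ℕ} (ℓ : Fin r → 𝒜 1) (i : ℕ) :
    (subPriddyComplex 𝒜 x ℓ).X i →ₗ[A] (priddyComplex 𝒜 x).X i :=
  TensorProduct.AlgebraTensorModule.map (LinearMap.id : A →ₗ[A] A)
    (((leftIdeal 𝒜 ℓ).mkQ.restrictScalars k).submoduleMap (dualPiece 𝒜 i)).dualMap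

/-- The class of `1` in `B₀`. -/
def bOne {r : ℕ} (ℓ : Fin r → 𝒜 1) : bPiece 𝒜 ℓ 0 :=
  ⟨(leftIdeal 𝒜 ℓ).mkQ 1, 1, by
    simpa [dualPiece] using Submodule.one_le.1 (le_refl (1 : Submodule k (QuadraticDual 𝒜))), rfl⟩

/-- The ideal of `A` generated by the linear forms `ℓ j`. -/
def linIdeal {r : ℕ} (ℓ : Fin r → 𝒜 1) : Ideal A :=
  Ideal.span (Set.range fun j => (ℓ j : A))

/-- The augmentation `A ⊗ B₀* → A / (ℓ)`, `a ⊗ φ ↦ φ(1) a`, where `B₀* = k`. -/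
def subPriddyAug {r : ℕ} (ℓ : Fin r → 𝒜 1) :
    (subPriddyComplex 𝒜 x ℓ).X 0 →ₗ[A] A ⧸ linIdeal 𝒜 ℓ :=
  (linIdeal 𝒜 ℓ).mkQ ∘ₗ (TensorProduct.AlgebraTensorModule.rid k A A).toLinearMap ∘ₗ
    TensorProduct.AlgebraTensorModule.map (LinearMap.id : A →ₗ[A] A)
      (Module.Dual.eval k (bPiece 𝒜 ℓ 0) (bOne 𝒜 ℓ))

end Priddy

end KoszulStrand

end

/-! The linear strand of a minimal resolution `F` is determined by two degrees of each term. If the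
module resolved vanishes below degree `d`, minimality makes `Fᵢ` vanish below degree `d + i` and
allows no nonzero boundary in degree `d + i`. So the degree `d + i + 1` part of `Fᵢ₊₁` maps
bijectively onto the cycles of that degree in `Fᵢ` (for `i = 0`, the kernel of the augmentation),
and by minimality these lie in the submodule generated in degree `d + i`. Let `G` be a complex with
`Gᵢ` free on generators of degree `d + i`, whose differentials are injective on generators and which
is exact one degree above them, with the same conditions at the augmentation. Such a `G` is then
matched with the strand by induction on `i`. This is `IsLinearStrandOf`, `exists_strandMap_zero`,
`exists_strandMap_succ` and `exists_comparison`.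

The complex `A ⊗ B*` meets these conditions because `B = A^!/L` is generated by the class of `1`,
with relations from `Q₂^⊥` and from degree one. Generation, `Bᵢ₊₁ = V* Bᵢ`, gives injectivity on
generators (`traceMul_injOn`). For exactness, a cycle `∑ xⱼ ⊗ ψⱼ` with `ψⱼ ∈ Bᵢ*` must be the
boundary of some `1 ⊗ φ`, i.e. one needs `φ ∈ Bᵢ₊₁*` with `φ · xⱼ* = ψⱼ`. The functional is read off
from an `A^!`-module: the sequences in `∏ Bⱼ` are extended by a copy of `k` on which `ξ` takes the
value `∑ ξ(xⱼ) ψⱼ(fᵢ)`. The cycle condition places `∑ ψⱼ(xₗ* m) xⱼ ⊗ xₗ` in `Q₂`, so `Q₂^⊥` acts by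
zero (`extRep`). The scalar part of the orbit map of `1` kills `L` and gives `φ`
(`exists_dual_bPiece_leftMul`). Using sequences avoids any need for the pieces of `B` to be
independent.

If the ideal `(ℓ)` has a linear resolution, the strand is the whole resolution, so the comparison
maps are bijective and carry exactness over to `A ⊗ B*` (`subPriddy_exact_succ`). -/

noncomputable section

open scoped TensorProduct

namespace KoszulStrand

variable {k A : Type u} [Field k] [CommRing A] [Algebra k A]

/-! ### Graded free modules -/

section GradedFree

variable (𝒜 : ℕ → Submodule k A) {X : Type*} [AddCommGroup X] [Module A X] {ι : Type*}

/-- `b` is a basis of homogeneous elements, with `b s` of degree `deg s`, and `gr` is the grading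
it induces. -/
def IsHomogeneousBasis (gr : ℕ → AddSubgroup X) (b : Module.Basis ι A X) (deg : ι → ℕ) : Prop :=
  ∀ n y, y ∈ gr n ↔ ∀ s, b.repr y s = 0 ∨ ∃ m, deg s + m = n ∧ b.repr y s ∈ 𝒜 m

variable {𝒜} {gr : ℕ → AddSubgroup X} {b : Module.Basis ι A X} {deg : ι → ℕ}

namespace IsHomogeneousBasis

variable [GradedAlgebra 𝒜]

theorem basis_mem (h : IsHomogeneousBasis 𝒜 gr b deg) (s : ι) : b s ∈ gr (deg s) := by
  classical
  rw [h]
  intro t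
  by_cases hst : s = t
  · subst hst
    exact Or.inr ⟨0, by simp, by simpa using SetLike.one_mem_graded 𝒜⟩
  · exact Or.inl (by simp [hst])

theorem smul_mem (h : IsHomogeneousBasis 𝒜 gr b deg) {m n p : ℕ} (hp : n + m = p) {a : A}
    (ha : a ∈ 𝒜 m) {y : X} (hy : y ∈ gr n) : a • y ∈ gr p := by
  rw [h] at hy ⊢
  intro s
  rcases hy s with h0 | ⟨l, hl, hc⟩
  · exact Or.inl (by simp [h0])
  · refine Or.inr ⟨m + l, by omega, ?_⟩
    simpa using SetLike.mul_mem_graded ha hc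

theorem smul_basis_mem (h : IsHomogeneousBasis 𝒜 gr b deg) {m : ℕ} {a : A} (ha : a ∈ 𝒜 m)
    (s : ι) : a • b s ∈ gr (deg s + m) :=
  h.smul_mem rfl ha (h.basis_mem s)

theorem closure_eq_top [Fintype ι] (h : IsHomogeneousBasis 𝒜 gr b deg) (y : X) :
    y ∈ AddSubgroup.closure {z | ∃ n, z ∈ gr n} := by
  classical
  rw [← b.sum_repr y]
  refine sum_mem fun s _ => ?_
  rw [← DirectSum.sum_support_decompose 𝒜 (b.repr y s), Finset.sum_smul]
  exact sum_mem fun m _ => AddSubgroup.subset_closure ⟨_, h.smul_basis_mem (SetLike.coe_mem _) s⟩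

theorem exists_proj [Fintype ι] (h : IsHomogeneousBasis 𝒜 gr b deg) (n : ℕ) :
    ∃ p : X →+ X, (∀ y ∈ gr n, p y = y) ∧ ∀ m, m ≠ n → ∀ y ∈ gr m, p y = 0 := by
  -- The projection takes the part of degree `n - deg s` of the `s`-th coordinate. The guard
  -- excludes `deg s > n`, where truncated subtraction would select the degree zero part.
  refine ⟨∑ s, if deg s ≤ n then ((LinearMap.toSpanSingleton A X (b s)).toAddMonoidHom.comp
    (GradedRing.proj 𝒜 (n - deg s))).comp (b.coord s).toAddMonoidHom else 0, ?_, ?_⟩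
  · intro y hy
    conv_rhs => rw [← b.sum_repr y]
    rw [AddMonoidHom.finsetSum_apply]
    refine Finset.sum_congr rfl fun s _ => ?_
    rcases (h n y).1 hy s with h0 | ⟨m, hm, hc⟩
    · split_ifs <;> simp [h0]
    · rw [if_pos (by omega)]
      have : n - deg s = m := by omega
      simp [this, GradedRing.proj_apply, DirectSum.decompose_of_mem_same 𝒜 hc]
  · intro l hl y hy
    rw [AddMonoidHom.finsetSum_apply]
    refine Finset.sum_eq_zero fun s _ => ?_
    rcases (h l y).1 hy s with h0 | ⟨m, hm, hc⟩
    · split_ifs <;> simp [h0]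
    · split_ifs with hs
      · have : m ≠ n - deg s := by omega
        simp [GradedRing.proj_apply, DirectSum.decompose_of_mem_ne 𝒜 hc this]
      · rfl

/-- In the lowest degree, a graded free module does not meet its submodule of decomposable
elements. -/
theorem eq_zero_of_mem_irrelevant_smul [Nontrivial A] (h : IsHomogeneousBasis 𝒜 gr b deg) {n : ℕ}
    (hlow : ∀ m < n, ∀ y ∈ gr m, y = 0) {y : X} (hy : y ∈ gr n)
    (hy' : y ∈ (HomogeneousIdeal.irrelevant 𝒜).toIdeal • (⊤ : Submodule A X)) : y = 0 := by
  refine b.ext_elem fun s => ?_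
  rw [map_zero, Finsupp.zero_apply]
  have h2 : b.repr y s ∈ (HomogeneousIdeal.irrelevant 𝒜).toIdeal := by
    have h3 : (HomogeneousIdeal.irrelevant 𝒜).toIdeal • (⊤ : Submodule A X) ≤
        Submodule.comap (b.coord s) (HomogeneousIdeal.irrelevant 𝒜).toIdeal := by
      rw [Submodule.smul_le]
      intro a ha w _
      rw [Submodule.mem_comap, map_smul, smul_eq_mul]
      exact Ideal.mul_mem_right _ _ ha
    exact h3 hy'
  -- A coordinate of degree zero vanishes because it lies in `A₊`. One of positive degree would need
  -- a basis vector of degree below `n`, which would be zero.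
  rcases (h n y).1 hy s with h0 | ⟨m, hm, hc⟩
  · exact h0
  · cases m with
    | zero =>
      have h4 := (HomogeneousIdeal.mem_irrelevant_iff 𝒜 _).1 h2
      rwa [GradedRing.proj_apply, DirectSum.decompose_of_mem_same 𝒜 hc] at h4
    | succ m => exact absurd (hlow _ (by omega) _ (h.basis_mem s)) (b.ne_zero s)

end IsHomogeneousBasis

/-- A homogeneous element in the range of a graded map has a homogeneous preimage. -/
theorem exists_homogeneous_preimage {X Y : Type*} [AddCommGroup X] [AddCommGroup Y]
    {gX : ℕ → AddSubgroup X} {gY : ℕ → AddSubgroup Y} (f : X →+ Y)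
    (hf : ∀ n, ∀ y ∈ gX n, f y ∈ gY n)
    (htop : ∀ y, y ∈ AddSubgroup.closure {z | ∃ n, z ∈ gX n}) {n : ℕ}
    (hp : ∃ p : Y →+ Y, (∀ y ∈ gY n, p y = y) ∧ ∀ m, m ≠ n → ∀ y ∈ gY m, p y = 0)
    {x : X} (hx : f x ∈ gY n) : ∃ x' ∈ gX n, f x' = f x := by
  obtain ⟨p, hp1, hp2⟩ := hp
  -- With `p (f x)` as target the claim is additive in `x`, so homogeneous `x` suffice, and those of
  -- degree other than `n` contribute zero.
  suffices h : ∃ x' ∈ gX n, f x' = p (f x) by rwa [hp1 _ hx] at h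
  clear hx
  induction htop x using AddSubgroup.closure_induction with
  | zero => exact ⟨0, zero_mem _, by simp⟩
  | add y z _ _ hy hz =>
    obtain ⟨y', hy', hy⟩ := hy
    obtain ⟨z', hz', hz⟩ := hz
    exact ⟨y' + z', add_mem hy' hz', by simp [hy, hz]⟩
  | neg y _ hy =>
    obtain ⟨y', hy', hy⟩ := hy
    exact ⟨-y', neg_mem hy', by simp [hy]⟩
  | mem y hy =>
    obtain ⟨m, hm⟩ := hy
    by_cases hmn : m = n
    · subst hmn
      exact ⟨y, hm, (hp1 _ (hf _ _ hm)).symm⟩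
    · exact ⟨0, zero_mem _, by rw [map_zero, hp2 m hmn _ (hf _ _ hm)]⟩

/-- A map from a free module generated in degree `D` to a graded free module that vanishes below
degree `D` is determined, together with the gradings, by its component of degree `D`. -/
theorem IsHomogeneousBasis.bijective_of_lowest [GradedAlgebra 𝒜] [Nontrivial A]
    {X Y : Type*} [AddCommGroup X] [Module A X] [AddCommGroup Y] [Module A Y] {ι κ : Type*}
    [Fintype ι] [Fintype κ] {gX : ℕ → AddSubgroup X} {gY : ℕ → AddSubgroup Y}
    {b : Module.Basis ι A X} {c : Module.Basis κ A Y} {D : ℕ} {deg : κ → ℕ}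
    (hb : IsHomogeneousBasis 𝒜 gX b fun _ => D) (hc : IsHomogeneousBasis 𝒜 gY c deg)
    (hlow : ∀ m < D, ∀ y ∈ gY m, y = 0) (e : X →ₗ[A] Y) (he : ∀ s, e (b s) ∈ gY D)
    (hinj : ∀ y ∈ gX D, e y = 0 → y = 0) (hsurj : ∀ y ∈ gY D, ∃ x ∈ gX D, e x = y) :
    (∀ n y, e y ∈ gY n ↔ y ∈ gX n) ∧ Function.Injective e ∧
      LinearMap.range e = Submodule.span A (gY D : Set Y) := by
  classical
  have hpre : ∀ t, ∃ x, deg t = D → x ∈ gX D ∧ e x = c t := by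
    intro t
    by_cases ht : deg t = D
    · obtain ⟨x, hx, hx'⟩ := hsurj (c t) (ht ▸ hc.basis_mem t)
      exact ⟨x, fun _ => ⟨hx, hx'⟩⟩
    · exact ⟨0, fun h => absurd h ht⟩
  choose g hg using hpre
  have hdeg : ∀ t, D ≤ deg t := fun t => by
    by_contra! hlt
    exact c.ne_zero t (hlow _ hlt _ (hc.basis_mem t))
  -- This will be a left inverse of `e`: it lifts the basis vectors of degree `D` and kills those of
  -- higher degree.
  let f : Y →ₗ[A] X := c.constr A fun t => if deg t = D then g t else 0
  have hfc : ∀ t, f (c t) = if deg t = D then g t else 0 := fun t => c.constr_basis A _ t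
  have hf : ∀ n, ∀ y ∈ gY n, f y ∈ gX n := by
    intro n y hy
    rw [← c.sum_repr y, map_sum]
    refine sum_mem fun t _ => ?_
    rw [map_smul, hfc]
    split_ifs with ht
    · rcases (hc n y).1 hy t with h0 | ⟨m, hm, hm'⟩
      · simp [h0]
      · exact hb.smul_mem (by omega) hm' (hg t ht).1
    · simp
  have hgr : ∀ n, ∀ y ∈ gX n, e y ∈ gY n := by
    intro n y hy
    rw [← b.sum_repr y, map_sum]
    refine sum_mem fun s _ => ?_
    rw [map_smul]
    rcases (hb n y).1 hy s with h0 | ⟨m, hm, hm'⟩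
    · simp [h0]
    · exact hc.smul_mem hm hm' (he s)
  have hef : ∀ y ∈ gY D, e (f y) = y := by
    intro y hy
    conv_rhs => rw [← c.sum_repr y]
    conv_lhs => rw [← c.sum_repr y, map_sum, map_sum]
    refine Finset.sum_congr rfl fun t _ => ?_
    rw [map_smul, map_smul, hfc]
    split_ifs with ht
    · rw [(hg t ht).2]
    · rcases (hc D y).1 hy t with h0 | ⟨m, hm, hm'⟩
      · simp [h0]
      · exact absurd (le_antisymm (by omega) (hdeg t)) ht
  have hfe : ∀ y, f (e y) = y := by
    have : f ∘ₗ e = LinearMap.id := b.ext fun s => by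
      -- The difference has degree `D` and is killed by `e`, since `e ∘ f` is the identity on `gY
      -- D`; injectivity in that degree finishes.
      have h1 : f (e (b s)) - b s ∈ gX D := sub_mem (hf _ _ (he s)) (hb.basis_mem s)
      have h2 := hinj _ h1 (by rw [map_sub, hef _ (he s), sub_self])
      simpa [sub_eq_zero] using h2
    exact fun y => LinearMap.congr_fun this y
  refine ⟨fun n y => ⟨fun h => hfe y ▸ hf n _ h, hgr n y⟩,
    Function.LeftInverse.injective hfe, le_antisymm ?_ ?_⟩
  · rintro _ ⟨y, rfl⟩
    rw [← b.sum_repr y, map_sum]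
    refine sum_mem fun s _ => ?_
    rw [map_smul]
    exact Submodule.smul_mem _ _ (Submodule.subset_span (he s))
  · rw [Submodule.span_le]
    intro y hy
    exact ⟨f y, hef y hy⟩

end GradedFree

/-! ### Comparison with minimal resolutions -/

namespace GradedComplex

variable {𝒜 : ℕ → Submodule k A} [GradedAlgebra 𝒜]

variable (𝒜) in
/-- `G` is a complex of free modules, with `Gᵢ` generated in degree `d + i`, and the augmented
complex `G → M` is exact in the degrees relevant to the linear strand of a minimal resolution
of `M`. -/
structure IsLinearStrandOf {M : Type u} [AddCommGroup M] [Module A M] (ℳ : ℕ → AddSubgroup M)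
    (d : ℕ) (G : GradedComplex A) (ε : G.X 0 →ₗ[A] M) : Prop where
  free : ∀ i, ∃ (r : ℕ) (b : Module.Basis (Fin r) A (G.X i)),
    IsHomogeneousBasis 𝒜 (G.gr i) b fun _ => d + i
  aug_mem : ∀ y ∈ G.gr 0 d, ε y ∈ ℳ d
  aug_inj : ∀ y ∈ G.gr 0 d, ε y = 0 → y = 0
  aug_surj : ∀ m ∈ ℳ d, ∃ y ∈ G.gr 0 d, ε y = m
  aug_exact : ∀ z ∈ G.gr 0 (d + 1), ε z = 0 ↔ z ∈ LinearMap.range (G.d 0)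
  inj : ∀ i, ∀ y ∈ G.gr (i + 1) (d + (i + 1)), G.d i y = 0 → y = 0
  exact : ∀ i, ∀ z ∈ G.gr (i + 1) (d + (i + 1) + 1), G.d i z = 0 →
    z ∈ LinearMap.range (G.d (i + 1))

/-- If the module resolved vanishes below degree `d`, then `Fᵢ` vanishes below degree `d + i`. -/
theorem IsMinimalFreeResolution.eq_zero_of_lt [Nontrivial A] {M : Type u} [AddCommGroup M]
    [Module A M] {ℳ : ℕ → AddSubgroup M} {F : GradedComplex A} {ε : F.X 0 →ₗ[A] M}
    (hF : F.IsMinimalFreeResolution 𝒜 ℳ ε) {d : ℕ} (hM : ∀ n < d, ∀ y ∈ ℳ n, y = 0) (i : ℕ) :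
    ∀ n < d + i, ∀ y ∈ F.gr i n, y = 0 := by
  induction i with
  | zero =>
    intro n
    induction n using Nat.strong_induction_on with
    | _ n ih =>
      intro hn y hy
      obtain ⟨r, b, deg, hb⟩ := hF.free 0
      -- Thus `y` is a boundary, so it lies in `A₊ F₀`; lower degrees vanish by the inner induction,
      -- which forces `y = 0`.
      have h0 : ε y = 0 := hM n (by omega) _ (hF.graded n y hy)
      obtain ⟨w, rfl⟩ := (hF.exact_zero y).1 h0
      exact IsHomogeneousBasis.eq_zero_of_mem_irrelevant_smul (b := b) hb
        (fun m hm => ih m hm (by omega)) hy (hF.minimal 0 ⟨w, rfl⟩)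
  | succ i ih' =>
    intro n
    induction n using Nat.strong_induction_on with
    | _ n ih =>
      intro hn y hy
      obtain ⟨r, b, deg, hb⟩ := hF.free (i + 1)
      obtain ⟨r', b', deg', hb'⟩ := hF.free i
      -- Here `n = d + i` is possible, where `Fᵢ` need not vanish; `d y` vanishes there because it
      -- lies in `A₊ Fᵢ` and all lower degrees are zero.
      have h0 : F.d i y = 0 := IsHomogeneousBasis.eq_zero_of_mem_irrelevant_smul (b := b') hb'
        (fun m hm => ih' m (by omega)) (F.d_mem i n y hy) (hF.minimal i ⟨y, rfl⟩)
      obtain ⟨w, rfl⟩ := (hF.exact_succ i y).1 h0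
      exact IsHomogeneousBasis.eq_zero_of_mem_irrelevant_smul (b := b) hb
        (fun m hm => ih m hm (by omega)) hy (hF.minimal (i + 1) ⟨w, rfl⟩)

/-- Boundaries vanish in the lowest degree. -/
theorem IsMinimalFreeResolution.eq_zero_of_mem_range [Nontrivial A] {M : Type u} [AddCommGroup M]
    [Module A M] {ℳ : ℕ → AddSubgroup M} {F : GradedComplex A} {ε : F.X 0 →ₗ[A] M}
    (hF : F.IsMinimalFreeResolution 𝒜 ℳ ε) {d : ℕ} (hM : ∀ n < d, ∀ y ∈ ℳ n, y = 0) (i : ℕ)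
    {y : F.X i} (hy : y ∈ F.gr i (d + i)) (hy' : y ∈ LinearMap.range (F.d i)) : y = 0 := by
  obtain ⟨r, b, deg, hb⟩ := hF.free i
  exact IsHomogeneousBasis.eq_zero_of_mem_irrelevant_smul (b := b) hb
    (hF.eq_zero_of_lt hM i) hy (hF.minimal i hy')

theorem IsGradedFree.exists_preimage {F : GradedComplex A} (hF : F.IsGradedFree 𝒜) {i n : ℕ}
    {y : F.X i} (hy : y ∈ F.gr i n) (hy' : y ∈ LinearMap.range (F.d i)) :
    ∃ w ∈ F.gr (i + 1) n, F.d i w = y := by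
  obtain ⟨w, rfl⟩ := hy'
  obtain ⟨r, b, deg, hb⟩ := hF (i + 1)
  obtain ⟨r', b', deg', hb'⟩ := hF i
  exact exists_homogeneous_preimage (F.d i).toAddMonoidHom (F.d_mem i)
    (IsHomogeneousBasis.closure_eq_top (b := b) hb)
    (IsHomogeneousBasis.exists_proj (b := b') hb' n) hy

/-- An identification of `Gᵢ` with the `i`-th term of the linear strand of `F`, respecting the
boundaries of degree `d + i + 1`. -/
structure IsStrandMap (F G : GradedComplex A) (d i : ℕ) (e : G.X i →ₗ[A] F.X i) : Prop where
  mem_iff : ∀ n y, e y ∈ F.gr i n ↔ y ∈ G.gr i n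
  injective : Function.Injective e
  range_eq : LinearMap.range e = Submodule.span A (F.gr i (d + i) : Set (F.X i))
  mem_range_iff : ∀ z ∈ G.gr i (d + i + 1),
    z ∈ LinearMap.range (G.d i) ↔ e z ∈ LinearMap.range (F.d i)

section Comparison

variable [Nontrivial A] {M : Type u} [AddCommGroup M] [Module A M]
  {ℳ : ℕ → AddSubgroup M} {F G : GradedComplex A} {ε : F.X 0 →ₗ[A] M} {ε' : G.X 0 →ₗ[A] M}
  {d : ℕ}

/-- Both augmentations are bijective in degree `d`; for `F` because boundaries vanish there. Lifting
the basis of `G₀` through `ε` therefore matches lowest degrees, and the boundaries of degree `d + 1`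
are on both sides the kernel of the augmentation. -/
theorem IsLinearStrandOf.exists_strandMap_zero (hG : G.IsLinearStrandOf 𝒜 ℳ d ε')
    (hF : F.IsMinimalFreeResolution 𝒜 ℳ ε) (hM : ∀ n < d, ∀ y ∈ ℳ n, y = 0)
    (hp : ∃ p : M →+ M, (∀ y ∈ ℳ d, p y = y) ∧ ∀ m, m ≠ d → ∀ y ∈ ℳ m, p y = 0) :
    ∃ e : G.X 0 →ₗ[A] F.X 0, IsStrandMap F G d 0 e ∧ ε ∘ₗ e = ε' := by
  obtain ⟨r, b, hb⟩ := hG.free 0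
  obtain ⟨r', c, deg, hc⟩ := hF.free 0
  have hsurj : ∀ m ∈ ℳ d, ∃ y ∈ F.gr 0 d, ε y = m := by
    intro m hm
    obtain ⟨y, rfl⟩ := hF.surjective m
    exact exists_homogeneous_preimage ε.toAddMonoidHom hF.graded
      (IsHomogeneousBasis.closure_eq_top (b := c) hc) hp hm
  have hbd : ∀ s, b s ∈ G.gr 0 d := fun s => hb.basis_mem s
  choose w hw hw' using fun s => hsurj _ (hG.aug_mem _ (hbd s))
  let e : G.X 0 →ₗ[A] F.X 0 := b.constr A w
  have heb : ∀ s, e (b s) = w s := fun s => b.constr_basis A w s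
  have hε : ε ∘ₗ e = ε' := b.ext fun s => by rw [LinearMap.comp_apply, heb, hw']
  have hε' : ∀ y, ε (e y) = ε' y := fun y => LinearMap.congr_fun hε y
  have hegr : ∀ y ∈ G.gr 0 d, e y ∈ F.gr 0 d := by
    intro y hy
    rw [← b.sum_repr y, map_sum]
    refine sum_mem fun s _ => ?_
    rw [map_smul, heb]
    rcases (hb d y).1 hy s with h0 | ⟨m, hm, hm'⟩
    · simp [h0]
    · exact IsHomogeneousBasis.smul_mem (b := c) hc hm hm' (hw s)
  obtain ⟨h1, h2, h3⟩ := IsHomogeneousBasis.bijective_of_lowest hb (c := c) hc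
    (hF.eq_zero_of_lt hM 0) e (fun s => (heb s).symm ▸ hw s)
    (fun y hy h0 => hG.aug_inj y hy (by rw [← hε', h0, map_zero]))
    (fun y hy => by
      obtain ⟨x, hx, hxy⟩ := hG.aug_surj _ (hF.graded d y hy)
      refine ⟨x, hx, sub_eq_zero.1 (hF.eq_zero_of_mem_range hM 0 (sub_mem (hegr x hx) hy)
        ((hF.exact_zero _).1 ?_))⟩
      rw [map_sub, hε', hxy, sub_self])
  refine ⟨e, ⟨h1, h2, h3, fun z hz => ?_⟩, hε⟩
  rw [← hG.aug_exact z hz, ← hε']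
  exact hF.exact_zero _

/-- Since `e` matches boundaries of degree `d + i + 1`, and both differentials are injective on the
lowest degree of the next term, those lowest degrees are identified. -/
theorem IsLinearStrandOf.exists_strandMap_succ (hA : IsStandardGraded 𝒜)
    (hG : G.IsLinearStrandOf 𝒜 ℳ d ε') (hF : F.IsMinimalFreeResolution 𝒜 ℳ ε)
    (hM : ∀ n < d, ∀ y ∈ ℳ n, y = 0) (i : ℕ) (e : G.X i →ₗ[A] F.X i)
    (he : IsStrandMap F G d i e) :
    ∃ e' : G.X (i + 1) →ₗ[A] F.X (i + 1), IsStrandMap F G d (i + 1) e' ∧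
      ∀ y, e (G.d i y) = F.d i (e' y) := by
  obtain ⟨r, b, hb⟩ := hG.free (i + 1)
  obtain ⟨r', c, deg, hc⟩ := hF.free (i + 1)
  have hGfree : G.IsGradedFree 𝒜 := fun j => by
    obtain ⟨r, b, hb⟩ := hG.free j
    exact ⟨r, b, _, hb⟩
  have hex : ∀ s, ∃ w ∈ F.gr (i + 1) (d + (i + 1)), F.d i w = e (G.d i (b s)) := fun s =>
    have hs := G.d_mem i _ _ (hb.basis_mem s)
    hF.free.exists_preimage ((he.mem_iff _ _).2 hs) ((he.mem_range_iff _ hs).1 ⟨_, rfl⟩)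
  choose w hw hw' using hex
  let e' : G.X (i + 1) →ₗ[A] F.X (i + 1) := b.constr A w
  have heb : ∀ s, e' (b s) = w s := fun s => b.constr_basis A w s
  have hcomm : ∀ y, e (G.d i y) = F.d i (e' y) := by
    have : e ∘ₗ G.d i = F.d i ∘ₗ e' := b.ext fun s => by
      rw [LinearMap.comp_apply, LinearMap.comp_apply, heb, hw']
    exact fun y => LinearMap.congr_fun this y
  have hegr : ∀ y ∈ G.gr (i + 1) (d + (i + 1)), e' y ∈ F.gr (i + 1) (d + (i + 1)) := by
    intro y hy
    rw [← b.sum_repr y, map_sum]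
    refine sum_mem fun s _ => ?_
    rw [map_smul, heb]
    rcases (hb _ y).1 hy s with h0 | ⟨m, hm, hm'⟩
    · simp [h0]
    · exact IsHomogeneousBasis.smul_mem (b := c) hc hm hm' (hw s)
  obtain ⟨h1, h2, h3⟩ := IsHomogeneousBasis.bijective_of_lowest hb (c := c) hc
    (hF.eq_zero_of_lt hM (i + 1)) e' (fun s => (heb s).symm ▸ hw s)
    (fun y hy h0 => hG.inj i y hy (he.injective (by rw [hcomm, h0, map_zero, map_zero])))
    (fun y hy => by
      -- Minimality is used here: the differential of a lowest-degree element stays in the linear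
      -- strand, which is the image of `e`.
      have hdy : F.d i y ∈ LinearMap.range e := by
        rw [he.range_eq]
        exact d_mem_span hA hF.free hF.minimal d i y (Submodule.subset_span hy)
      obtain ⟨z, hz⟩ := hdy
      have hz1 : z ∈ G.gr i (d + (i + 1)) := (he.mem_iff _ _).1 (hz ▸ F.d_mem i _ y hy)
      have hz2 : z ∈ LinearMap.range (G.d i) := (he.mem_range_iff z hz1).2 ⟨y, hz.symm⟩
      obtain ⟨x, hx, rfl⟩ := hGfree.exists_preimage hz1 hz2
      refine ⟨x, hx, sub_eq_zero.1 (hF.eq_zero_of_mem_range hM (i + 1) (sub_mem (hegr x hx) hy)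
        ((hF.exact_succ i _).1 ?_))⟩
      rw [map_sub, ← hcomm, hz, sub_self])
  refine ⟨e', ⟨h1, h2, h3, fun z hz => ?_⟩, hcomm⟩
  constructor
  · rintro ⟨y, rfl⟩
    refine (hF.exact_succ i _).1 ?_
    rw [← hcomm, show G.d i (G.d (i + 1) y) = 0 from LinearMap.congr_fun (G.d_comp_d i) y, map_zero]
  · intro h
    refine hG.exact i z hz (he.injective ?_)
    rw [hcomm, map_zero]
    exact (hF.exact_succ i _).2 h

/-- The comparison map identifies `G` with the linear strand of `F`. -/
theorem IsLinearStrandOf.exists_comparison (hA : IsStandardGraded 𝒜)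
    (hG : G.IsLinearStrandOf 𝒜 ℳ d ε') (hF : F.IsMinimalFreeResolution 𝒜 ℳ ε)
    (hM : ∀ n < d, ∀ y ∈ ℳ n, y = 0)
    (hp : ∃ p : M →+ M, (∀ y ∈ ℳ d, p y = y) ∧ ∀ m, m ≠ d → ∀ y ∈ ℳ m, p y = 0) :
    ∃ e : ∀ i, G.X i →ₗ[A] F.X i, (∀ i, IsStrandMap F G d i (e i)) ∧ ε ∘ₗ e 0 = ε' ∧
      ∀ i y, e i (G.d i y) = F.d i (e (i + 1) y) := by
  obtain ⟨e₀, he₀, hε⟩ := hG.exists_strandMap_zero hF hM hp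
  choose next hnext hcomm using hG.exists_strandMap_succ hA hF hM
  let E : ∀ i, {e : G.X i →ₗ[A] F.X i // IsStrandMap F G d i e} := fun i =>
    Nat.rec ⟨e₀, he₀⟩ (fun i e => ⟨next i e.1 e.2, hnext i e.1 e.2⟩) i
  exact ⟨fun i => (E i).1, fun i => (E i).2, hε, fun i => hcomm i (E i).1 (E i).2⟩

theorem IsLinearStrandOf.nonempty_gradedIso (hA : IsStandardGraded 𝒜)
    (hG : G.IsLinearStrandOf 𝒜 ℳ d ε') (hF : F.IsMinimalFreeResolution 𝒜 ℳ ε)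
    (hM : ∀ n < d, ∀ y ∈ ℳ n, y = 0)
    (hp : ∃ p : M →+ M, (∀ y ∈ ℳ d, p y = y) ∧ ∀ m, m ≠ d → ∀ y ∈ ℳ m, p y = 0) :
    Nonempty ((F.linearStrand hA hF.free hF.minimal d).GradedIso G) := by
  obtain ⟨e, he, -, hcomm⟩ := hG.exists_comparison hA hF hM hp
  let E : ∀ i, G.X i ≃ₗ[A] Submodule.span A (F.gr i (d + i) : Set (F.X i)) := fun i =>
    (LinearEquiv.ofInjective (e i) (he i).injective).trans
      (LinearEquiv.ofEq _ _ (he i).range_eq)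
  have hE : ∀ i y, (E i y : F.X i) = e i y :=
    fun i y => rfl
  have hEs : ∀ i y, e i ((E i).symm y) = (y : F.X i) := fun i y => by
    rw [← hE, LinearEquiv.apply_symm_apply]
  exact ⟨⟨fun i => (E i).symm,
    fun i y => (he i).injective
      ((hEs i _).trans ((hcomm i _).trans (congrArg (F.d i) (hEs (i + 1) y))).symm),
    fun i n y => ((he i).mem_iff n _).symm.trans
      (Iff.of_eq (congrArg (fun z => z ∈ F.gr i n) (hEs i y)))⟩⟩

end Comparison

end GradedComplex

/-! ### The complex attached to a module over the quadratic dual -/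

section DualComplex

variable {𝒜 : ℕ → Submodule k A}

theorem IsStandardGraded.exists_algebraMap (hA : IsStandardGraded 𝒜) {a : A} (ha : a ∈ 𝒜 0) :
    ∃ c : k, algebraMap k A c = a := by
  rw [hA 0, pow_zero, Submodule.mem_one] at ha
  exact ha

/-- The map `A ⊗ W* → A`, `a ⊗ φ ↦ φ(w) a`. -/
def evalTensor {W : Type u} [AddCommGroup W] [Module k W] (w : W) :
    A ⊗[k] Module.Dual k W →ₗ[A] A :=
  (TensorProduct.AlgebraTensorModule.rid k A A).toLinearMap ∘ₗ
    TensorProduct.AlgebraTensorModule.map (LinearMap.id : A →ₗ[A] A) (Module.Dual.eval k W w)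

@[simp]
theorem evalTensor_tmul {W : Type u} [AddCommGroup W] [Module k W] (w : W) (a : A)
    (φ : Module.Dual k W) : evalTensor w (a ⊗ₜ[k] φ) = φ w • a := by
  simp [evalTensor]

theorem sum_smul_basis_eq_zero {n : ℕ} (x : Module.Basis (Fin n) k (𝒜 1)) {c : Fin n → k}
    (h : ∑ j, c j • (x j : A) = 0) (j : Fin n) : c j = 0 := by
  have h' : ∑ j, c j • x j = 0 := by
    ext
    simpa using h
  exact Fintype.linearIndependent_iff.1 x.linearIndependent c h' j

theorem basis_coord_sum {n : ℕ} (x : Module.Basis (Fin n) k (𝒜 1)) (ξ : Module.Dual k (𝒜 1)) :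
    ∑ j, ξ (x j) • x.coord j = ξ :=
  x.ext fun l => by simp

variable {M : Type u} [AddCommGroup M] [Module k M] [Module (QuadraticDual 𝒜) M]
  [IsScalarTower k (QuadraticDual 𝒜) M] {N : ℕ → Submodule k M}
  {hN : ∀ i (ξ : Module.Dual k (𝒜 1)), ∀ m ∈ N i, dualGen 𝒜 ξ • m ∈ N (i + 1)}

variable (hN) in
theorem leftMul_add (i : ℕ) (ξ η : Module.Dual k (𝒜 1)) :
    leftMul 𝒜 N hN i (ξ + η) = leftMul 𝒜 N hN i ξ + leftMul 𝒜 N hN i η := by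
  ext
  simp [add_smul]

variable (hN) in
theorem leftMul_smul (i : ℕ) (c : k) (ξ : Module.Dual k (𝒜 1)) :
    leftMul 𝒜 N hN i (c • ξ) = c • leftMul 𝒜 N hN i ξ := by
  ext
  simp

variable (hN) in
/-- Left multiplication as a linear function of `ξ`. -/
def leftMulHom (i : ℕ) : Module.Dual k (𝒜 1) →ₗ[k] N i →ₗ[k] N (i + 1) where
  toFun := leftMul 𝒜 N hN i
  map_add' := leftMul_add hN i
  map_smul' := leftMul_smul hN i

variable {n : ℕ} (x : Module.Basis (Fin n) k (𝒜 1))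

theorem leftMul_eq_sum (i : ℕ) (ξ : Module.Dual k (𝒜 1)) (m : N i) :
    leftMul 𝒜 N hN i ξ m = ∑ j, ξ (x j) • leftMul 𝒜 N hN i (x.coord j) m :=
  calc leftMulHom hN i ξ m = leftMulHom hN i (∑ j, ξ (x j) • x.coord j) m := by
        rw [basis_coord_sum]
    _ = _ := by
        rw [map_sum, LinearMap.sum_apply]
        simp only [map_smul, LinearMap.smul_apply]
        rfl

/-- Evaluating at `m` turns the differential into a linear form whose coefficients are the numbers
`φ (xⱼ* m)`; all later computations with cycles go through this formula. -/
theorem evalTensor_traceMul_tmul (i : ℕ) (a : A) (φ : Module.Dual k (N (i + 1))) (m : N i) :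
    evalTensor m (traceMul 𝒜 N hN x i (a ⊗ₜ[k] φ)) =
      (∑ j, φ (leftMul 𝒜 N hN i (x.coord j) m) • (x j : A)) * a := by
  simp [traceMul_tmul, rightMul_apply, Finset.sum_mul]

/-- The complex is contravariant in the graded `A^!`-module; this is what makes `A ⊗ B*` a
subcomplex of the Priddy complex. -/
theorem map_dualMap_traceMul {M' : Type u} [AddCommGroup M'] [Module k M']
    [Module (QuadraticDual 𝒜) M'] [IsScalarTower k (QuadraticDual 𝒜) M'] {N' : ℕ → Submodule k M'}
    {hN' : ∀ i (ξ : Module.Dual k (𝒜 1)), ∀ m ∈ N' i, dualGen 𝒜 ξ • m ∈ N' (i + 1)}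
    (g : ∀ i, N i →ₗ[k] N' i)
    (hg : ∀ i ξ m, g (i + 1) (leftMul 𝒜 N hN i ξ m) = leftMul 𝒜 N' hN' i ξ (g i m)) (i : ℕ)
    (z : A ⊗[k] Module.Dual k (N' (i + 1))) :
    TensorProduct.AlgebraTensorModule.map (LinearMap.id : A →ₗ[A] A) (g i).dualMap
        (traceMul 𝒜 N' hN' x i z) =
      traceMul 𝒜 N hN x i (TensorProduct.AlgebraTensorModule.map (LinearMap.id : A →ₗ[A] A)
        (g (i + 1)).dualMap z) := by
  induction z with
  | zero => simp
  | add y z hy hz => simp only [map_add, hy, hz]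
  | tmul a φ =>
    simp only [traceMul_tmul, map_sum, TensorProduct.AlgebraTensorModule.map_tmul,
      LinearMap.id_apply]
    refine Finset.sum_congr rfl fun j _ => congrArg _ (LinearMap.ext fun m => ?_)
    simp [rightMul_apply, hg]

theorem isHomogeneousBasis_tensor {W : Type u} {ι : Type*} [AddCommGroup W] [Module k W] [Fintype ι]
    (β : Module.Basis ι k (Module.Dual k W)) (i : ℕ) :
    IsHomogeneousBasis 𝒜 (fun l => AddSubgroup.closure
        {z | ∃ m, m + i = l ∧ ∃ a ∈ 𝒜 m, ∃ φ : Module.Dual k W, z = a ⊗ₜ[k] φ})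
      (Algebra.TensorProduct.basis A β) fun _ => i := by
  refine fun l y => ⟨fun hy => ?_, fun hy => ?_⟩
  · induction hy using AddSubgroup.closure_induction with
    | zero => exact fun s => Or.inl (by simp)
    | add y z _ _ hy hz =>
      intro s
      rw [map_add, Finsupp.add_apply]
      rcases hy s with h1 | ⟨m, hm, h1⟩
      · rw [h1, zero_add]; exact hz s
      · rcases hz s with h2 | ⟨m', hm', h2⟩
        · rw [h2, add_zero]; exact Or.inr ⟨m, hm, h1⟩
        · obtain rfl : m = m' := by omega
          exact Or.inr ⟨m, hm, add_mem h1 h2⟩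
    | neg y _ hy =>
      intro s
      rw [map_neg, Finsupp.neg_apply]
      rcases hy s with h1 | ⟨m, hm, h1⟩
      · exact Or.inl (by rw [h1, neg_zero])
      · exact Or.inr ⟨m, hm, neg_mem h1⟩
    | mem y hy =>
      obtain ⟨m, hm, a, ha, φ, rfl⟩ := hy
      refine fun s => Or.inr ⟨m, (add_comm _ _).trans hm, ?_⟩
      have e1 : (Algebra.TensorProduct.basis A β).repr (a ⊗ₜ[k] φ) s = β.repr φ s • a := by
        simp [Algebra.TensorProduct.basis_repr_tmul, Algebra.smul_def, mul_comm]
      rw [e1]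
      exact Submodule.smul_mem _ _ ha
  · rw [← (Algebra.TensorProduct.basis A β).sum_repr y]
    refine sum_mem fun s _ => ?_
    rw [Algebra.TensorProduct.basis_apply, TensorProduct.smul_tmul', smul_eq_mul, mul_one]
    rcases hy s with h1 | ⟨m, hm, h1⟩
    · rw [h1, TensorProduct.zero_tmul]
      exact zero_mem _
    · exact AddSubgroup.subset_closure ⟨m, (add_comm _ _).trans hm, _, h1, _, rfl⟩

/-! ### The grading of `A ⊗ M*` and its two lowest degrees. -/

section Grading

variable [GradedAlgebra 𝒜]

theorem exists_basis_dualComplex (i : ℕ) [Module.Finite k (N i)] :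
    ∃ (r : ℕ) (b : Module.Basis (Fin r) A ((dualComplex 𝒜 N hN x).X i)),
      IsHomogeneousBasis 𝒜 ((dualComplex 𝒜 N hN x).gr i) b fun _ => i :=
  ⟨_, _, isHomogeneousBasis_tensor (Module.finBasis k (Module.Dual k (N i))) i⟩

theorem tmul_mem_gr {i m l : ℕ} (hl : m + i = l) {a : A} (ha : a ∈ 𝒜 m)
    (φ : Module.Dual k (N i)) :
    (a ⊗ₜ[k] φ : A ⊗[k] Module.Dual k (N i)) ∈ (dualComplex 𝒜 N hN x).gr i l :=
  AddSubgroup.subset_closure ⟨m, hl, a, ha, φ, rfl⟩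

theorem exists_eq_one_tmul (hA : IsStandardGraded 𝒜) {i : ℕ} {z : A ⊗[k] Module.Dual k (N i)}
    (hz : z ∈ (dualComplex 𝒜 N hN x).gr i i) :
    ∃ φ : Module.Dual k (N i), z = 1 ⊗ₜ[k] φ := by
  induction hz using AddSubgroup.closure_induction with
  | zero => exact ⟨0, by simp⟩
  | add y z _ _ hy hz =>
    obtain ⟨φ, rfl⟩ := hy
    obtain ⟨ψ, rfl⟩ := hz
    exact ⟨φ + ψ, (TensorProduct.tmul_add _ _ _).symm⟩
  | neg y _ hy =>
    obtain ⟨φ, rfl⟩ := hy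
    exact ⟨-φ, (TensorProduct.tmul_neg _ _).symm⟩
  | mem y hy =>
    obtain ⟨m, hm, a, ha, φ, rfl⟩ := hy
    obtain rfl : m = 0 := by omega
    obtain ⟨c, rfl⟩ := hA.exists_algebraMap ha
    refine ⟨c • φ, ?_⟩
    rw [Algebra.algebraMap_eq_smul_one, TensorProduct.smul_tmul]

theorem exists_eq_sum_tmul {i l : ℕ} (hl : l = i + 1) {z : A ⊗[k] Module.Dual k (N i)}
    (hz : z ∈ (dualComplex 𝒜 N hN x).gr i l) :
    ∃ ψ : Fin n → Module.Dual k (N i), z = ∑ j, (x j : A) ⊗ₜ[k] ψ j := by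
  induction hz using AddSubgroup.closure_induction with
  | zero => exact ⟨0, by simp⟩
  | add y z _ _ hy hz =>
    obtain ⟨φ, rfl⟩ := hy
    obtain ⟨ψ, rfl⟩ := hz
    exact ⟨φ + ψ, by simp [TensorProduct.tmul_add, Finset.sum_add_distrib]⟩
  | neg y _ hy =>
    obtain ⟨φ, rfl⟩ := hy
    exact ⟨-φ, by simp [TensorProduct.tmul_neg]⟩
  | mem y hy =>
    obtain ⟨m, hm, a, ha, φ, rfl⟩ := hy
    obtain rfl : m = 1 := by omega
    refine ⟨fun j => x.repr ⟨a, ha⟩ j • φ, ?_⟩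
    have h : a = ∑ j, x.repr ⟨a, ha⟩ j • (x j : A) := by
      have h := congrArg Subtype.val (x.sum_repr ⟨a, ha⟩).symm
      rw [AddSubmonoidClass.coe_finsetSum] at h
      simpa only [Submodule.coe_smul] using h
    conv_lhs => rw [h]
    rw [TensorProduct.sum_tmul]
    exact Finset.sum_congr rfl fun j _ => TensorProduct.smul_tmul _ _ _

theorem traceMul_mem_irrelevant_smul (i : ℕ) (z : A ⊗[k] Module.Dual k (N (i + 1))) :
    traceMul 𝒜 N hN x i z ∈ (HomogeneousIdeal.irrelevant 𝒜).toIdeal •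
      (⊤ : Submodule A (A ⊗[k] Module.Dual k (N i))) := by
  induction z with
  | zero => simp
  | add y z hy hz =>
    rw [map_add]
    exact add_mem hy hz
  | tmul a φ =>
    rw [traceMul_tmul]
    refine sum_mem fun j _ => ?_
    have h1 : (x j : A) ∈ (HomogeneousIdeal.irrelevant 𝒜).toIdeal := by
      refine (HomogeneousIdeal.mem_irrelevant_iff 𝒜 _).2 ?_
      rw [GradedRing.proj_apply, DirectSum.decompose_of_mem_ne 𝒜 (x j).2 one_ne_zero]
    rw [← smul_eq_mul, ← TensorProduct.smul_tmul']
    exact Submodule.smul_mem_smul h1 trivial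

/-- The lowest degree consists of the `1 ⊗ φ`. If its differential vanishes, independence of the
`xⱼ` gives `φ (xⱼ* m) = 0`, so `φ` vanishes on `V* Mᵢ`; `hgen` is the dual form of `Mᵢ₊₁ = V* Mᵢ`.
-/
theorem traceMul_injOn (hA : IsStandardGraded 𝒜) (i : ℕ)
    (hgen : ∀ φ : Module.Dual k (N (i + 1)), (∀ ξ m, φ (leftMul 𝒜 N hN i ξ m) = 0) → φ = 0)
    {z : A ⊗[k] Module.Dual k (N (i + 1))}
    (hz : z ∈ (dualComplex 𝒜 N hN x).gr (i + 1) (i + 1)) (h : traceMul 𝒜 N hN x i z = 0) :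
    z = 0 := by
  obtain ⟨φ, rfl⟩ := exists_eq_one_tmul x hA hz
  rw [hgen φ fun ξ m => ?_, TensorProduct.tmul_zero]
  have h1 := evalTensor_traceMul_tmul (hN := hN) x i 1 φ m
  rw [h, map_zero, mul_one] at h1
  have h2 := sum_smul_basis_eq_zero x h1.symm
  rw [leftMul_eq_sum x, map_sum]
  exact Finset.sum_eq_zero fun j _ => by rw [map_smul, h2, smul_zero]

end Grading

/-! ### Extending a graded module by a functional -/

variable (hN) in
/-- Multiplication by `ξ ∈ V*` on sequences `(fⱼ)` with `fⱼ ∈ Mⱼ`. -/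
def shiftMul (ξ : Module.Dual k (𝒜 1)) : (∀ j, N j) →ₗ[k] (∀ j, N j) :=
  LinearMap.pi fun j => match j with
    | 0 => 0
    | j + 1 => leftMul 𝒜 N hN j ξ ∘ₗ LinearMap.proj j

@[simp]
theorem shiftMul_zero (ξ : Module.Dual k (𝒜 1)) (f : ∀ j, N j) : shiftMul hN ξ f 0 = 0 := rfl

@[simp]
theorem shiftMul_succ (ξ : Module.Dual k (𝒜 1)) (f : ∀ j, N j) (j : ℕ) :
    shiftMul hN ξ f (j + 1) = leftMul 𝒜 N hN j ξ (f j) := rfl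

theorem shiftMul_add (ξ η : Module.Dual k (𝒜 1)) :
    shiftMul hN (ξ + η) = shiftMul hN ξ + shiftMul hN η := by
  refine LinearMap.ext fun f => funext fun j => ?_
  cases j with
  | zero => simp
  | succ j => simp [leftMul_add]

theorem shiftMul_smul (c : k) (ξ : Module.Dual k (𝒜 1)) :
    shiftMul hN (c • ξ) = c • shiftMul hN ξ := by
  refine LinearMap.ext fun f => funext fun j => ?_
  cases j with
  | zero => simp
  | succ j => simp [leftMul_smul]

variable (hN) in
/-- The action of `ξ ∈ V*` on the extension of the module of sequences `(fⱼ)` by `k` in which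
`ξ · (f, c)` has second component `∑ⱼ ξ(xⱼ) ψⱼ(fᵢ)`. -/
def extAction (i : ℕ) (ψ : Fin n → Module.Dual k (N i)) :
    Module.Dual k (𝒜 1) →ₗ[k] Module.End k ((∀ j, N j) × k) :=
  LinearMap.mk₂ k (fun ξ p => (shiftMul hN ξ p.1, ∑ j, ξ (x j) * ψ j (p.1 i)))
    (fun _ _ _ => by simp [shiftMul_add, add_mul, Finset.sum_add_distrib])
    (fun _ _ _ => by simp [shiftMul_smul, mul_assoc, Finset.mul_sum])
    (fun _ _ _ => by simp [mul_add, Finset.sum_add_distrib])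
    (fun _ _ _ => by simp [mul_left_comm, Finset.mul_sum])

theorem extAction_apply (i : ℕ) (ψ : Fin n → Module.Dual k (N i)) (ξ : Module.Dual k (𝒜 1))
    (p : (∀ j, N j) × k) :
    extAction hN x i ψ ξ p = (shiftMul hN ξ p.1, ∑ j, ξ (x j) * ψ j (p.1 i)) := rfl

/-- A quadratic element acts on sequences as in `M`, shifted by two, and its scalar part is its
pairing with `∑ ψⱼ(xₗ* fᵢ₋₁) xⱼ ⊗ xₗ` (zero if `i = 0`). So elements of `Q₂^⊥` act by zero once this
tensor lies in `Q₂`. -/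
theorem lift_extAction_tensorTwo (i : ℕ) (ψ : Fin n → Module.Dual k (N i))
    (p : (∀ j, N j) × k) (θ : Module.Dual k (𝒜 1) ⊗[k] Module.Dual k (𝒜 1)) :
    let q := TensorAlgebra.lift k (extAction hN x i ψ) (tensorTwo 𝒜 θ) p
    q.1 0 = 0 ∧ q.1 1 = 0 ∧ (∀ j, q.1 (j + 2) = leftMulTwo 𝒜 N hN j (p.1 j) θ) ∧
      q.2 = TensorProduct.dualDistrib k (𝒜 1) (𝒜 1) θ
        (∑ j, ∑ l, ψ j (shiftMul hN (x.coord l) p.1 i) • (x j ⊗ₜ[k] x l)) := by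
  induction θ with
  | zero => simp
  | add θ θ' h h' =>
    obtain ⟨h1, h2, h3, h4⟩ := h
    obtain ⟨h1', h2', h3', h4'⟩ := h'
    refine ⟨?_, ?_, fun j => ?_, ?_⟩
    · simp [h1, h1']
    · simp [h2, h2']
    · simp [h3, h3']
    · simp only [map_add, LinearMap.add_apply, Prod.snd_add, h4, h4']
  | tmul ξ η =>
    have e : TensorAlgebra.lift k (extAction hN x i ψ) (tensorTwo 𝒜 (ξ ⊗ₜ η)) p =
        extAction hN x i ψ ξ (extAction hN x i ψ η p) := by
      simp [tensorTwo]
    have e2 : shiftMul hN η p.1 i = ∑ l, η (x l) • shiftMul hN (x.coord l) p.1 i := by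
      cases i with
      | zero => simp
      | succ i =>
        simp only [shiftMul_succ]
        exact leftMul_eq_sum x i η (p.1 i)
    refine ⟨?_, ?_, fun j => ?_, ?_⟩
    · rw [e]; simp [extAction_apply]
    · rw [e]; simp [extAction_apply, shiftMul]
    · rw [e]; simp [extAction_apply, leftMulTwo]
    · rw [e]
      simp only [extAction_apply, e2, map_sum, map_smul, smul_eq_mul,
        TensorProduct.dualDistrib_apply, Finset.mul_sum]
      exact Finset.sum_congr rfl fun j _ => Finset.sum_congr rfl fun l _ => by ring

variable (hN) in
/-- The representation of the quadratic dual on the extension. -/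
def extRep (i : ℕ) (ψ : Fin n → Module.Dual k (N i))
    (h : ∀ f : ∀ j, N j,
      ∑ j, ∑ l, ψ j (shiftMul hN (x.coord l) f i) • ((x j : A) * (x l : A)) = 0) :
    QuadraticDual 𝒜 →ₐ[k] Module.End k ((∀ j, N j) × k) :=
  RingQuot.liftAlgHom k ⟨TensorAlgebra.lift k (extAction hN x i ψ), by
    rintro _ _ ⟨θ, hθ⟩
    rw [map_zero]
    refine LinearMap.ext fun p => ?_
    obtain ⟨h1, h2, h3, h4⟩ := lift_extAction_tensorTwo (hN := hN) x i ψ p θ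
    refine Prod.ext (funext fun j => ?_) ?_
    · match j with
      | 0 => exact h1
      | 1 => exact h2
      | j + 2 => exact (h3 j).trans (leftMulTwo_eq_zero 𝒜 N hN j _ θ hθ)
    · refine h4.trans ?_
      -- The hypothesis `h` says that the tensor paired with `θ` is in the kernel of multiplication,
      -- that is, in `Q₂`.
      refine (Submodule.mem_dualAnnihilator _).1 hθ _ ?_
      simpa [mulTwo] using h p.1⟩

theorem extRep_dualGen (i : ℕ) (ψ : Fin n → Module.Dual k (N i))
    (h : ∀ f : ∀ j, N j,
      ∑ j, ∑ l, ψ j (shiftMul hN (x.coord l) f i) • ((x j : A) * (x l : A)) = 0)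
    (ξ : Module.Dual k (𝒜 1)) (p : (∀ j, N j) × k) :
    extRep hN x i ψ h (dualGen 𝒜 ξ) p = (shiftMul hN ξ p.1, ∑ j, ξ (x j) * ψ j (p.1 i)) := by
  simp [extRep, dualGen, extAction_apply]

end DualComplex

/-! ### The module `B = A^! / L` -/

section LeftModule

variable {𝒜 : ℕ → Submodule k A} {r : ℕ} (ℓ : Fin r → 𝒜 1)

theorem finite_bPiece [Module.Finite k (𝒜 1)] (i : ℕ) : Module.Finite k (bPiece 𝒜 ℓ i) := by
  have h : (LinearMap.range (dualGen 𝒜)).FG := by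
    rw [← Submodule.map_top]
    exact Module.Finite.fg_top.map _
  exact Module.Finite.of_fg ((h.pow i).map _)

theorem dual_bPiece_eq_zero (i : ℕ) (φ : Module.Dual k (bPiece 𝒜 ℓ (i + 1)))
    (h : ∀ ξ m, φ (leftMul 𝒜 _ (dualGen_smul_mem_bPiece 𝒜 ℓ) i ξ m) = 0) : φ = 0 := by
  -- Extending `φ` to all of `B` frees the induction on products from membership proofs.
  obtain ⟨φ', hφ'⟩ := LinearMap.exists_extend φ
  have hφ'' : ∀ m : bPiece 𝒜 ℓ (i + 1), φ' m = φ m := fun m => LinearMap.congr_fun hφ' m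
  have key : ∀ a ∈ dualPiece 𝒜 (i + 1), φ' ((leftIdeal 𝒜 ℓ).mkQ a) = 0 := by
    intro a ha
    rw [dualPiece, pow_succ'] at ha
    induction ha using Submodule.mul_induction_on' with
    | mem_mul_mem b hb c hc =>
      obtain ⟨ξ, rfl⟩ := hb
      have := h ξ ⟨(leftIdeal 𝒜 ℓ).mkQ c, c, hc, rfl⟩
      rw [← hφ''] at this
      exact this
    | add b _ c _ hb hc => rw [map_add, map_add, hb, hc, add_zero]
  ext ⟨_, a, ha, rfl⟩
  rw [← hφ'']
  exact key a ha

theorem exists_smul_bOne (m : bPiece 𝒜 ℓ 0) : ∃ c : k, m = c • bOne 𝒜 ℓ := by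
  obtain ⟨_, a, ha, rfl⟩ := m
  obtain ⟨c, rfl⟩ : ∃ c : k, algebraMap k _ c = a := by
    rwa [dualPiece, pow_zero, SetLike.mem_coe, Submodule.mem_one] at ha
  refine ⟨c, Subtype.ext ?_⟩
  change (leftIdeal 𝒜 ℓ).mkQ _ = c • (leftIdeal 𝒜 ℓ).mkQ 1
  rw [Algebra.algebraMap_eq_smul_one]
  rfl

theorem leftMul_bOne_eq_zero {ξ : Module.Dual k (𝒜 1)} (hξ : ∀ j, ξ (ℓ j) = 0) :
    leftMul 𝒜 _ (dualGen_smul_mem_bPiece 𝒜 ℓ) 0 ξ (bOne 𝒜 ℓ) = 0 := by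
  refine Subtype.ext ((Submodule.Quotient.mk_eq_zero (leftIdeal 𝒜 ℓ)).2 ?_)
  change dualGen 𝒜 ξ * 1 ∈ leftIdeal 𝒜 ℓ
  rw [mul_one]
  exact Submodule.subset_span ⟨ξ, hξ, rfl⟩

variable (𝒜) in
/-- The augmentation of the quadratic dual. -/
def dualAug : QuadraticDual 𝒜 →ₐ[k] k :=
  RingQuot.liftAlgHom k ⟨TensorAlgebra.lift k 0, by
    rintro _ _ ⟨θ, hθ⟩
    clear hθ
    refine Eq.trans ?_ (map_zero _).symm
    induction θ with
    | zero => simp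
    | add a b ha hb => simp [ha, hb]
    | tmul ξ η => simp [tensorTwo]⟩

@[simp]
theorem dualAug_dualGen (ξ : Module.Dual k (𝒜 1)) : dualAug 𝒜 (dualGen 𝒜 ξ) = 0 := by
  simp [dualAug, dualGen]

/-- A functional on `A^!` that vanishes on `L` induces functionals on the components of `B`. -/
theorem exists_dual_bPiece (f : QuadraticDual 𝒜 →ₗ[k] k) (hf : ∀ a ∈ leftIdeal 𝒜 ℓ, f a = 0)
    (i : ℕ) : ∃ φ : Module.Dual k (bPiece 𝒜 ℓ i), ∀ a (h : (leftIdeal 𝒜 ℓ).mkQ a ∈ bPiece 𝒜 ℓ i),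
      φ ⟨(leftIdeal 𝒜 ℓ).mkQ a, h⟩ = f a := by
  -- The functional is only `k`-linear while `L` is an `A^!`-submodule, so the descent is done by
  -- hand.
  let g : (QuadraticDual 𝒜 ⧸ leftIdeal 𝒜 ℓ) →ₗ[k] k :=
    { toFun := Quotient.lift f fun a b hab => by
        have := hf _ ((Submodule.quotientRel_def _).1 hab)
        rwa [map_sub, sub_eq_zero] at this
      map_add' := by
        rintro ⟨a⟩ ⟨b⟩
        exact map_add f a b
      map_smul' := by
        rintro c ⟨a⟩
        exact map_smul f c a }
  exact ⟨g ∘ₗ (bPiece 𝒜 ℓ i).subtype, fun a h => rfl⟩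

theorem exists_dual_bOne : ∃ φ : Module.Dual k (bPiece 𝒜 ℓ 0), φ (bOne 𝒜 ℓ) = 1 := by
  obtain ⟨φ, hφ⟩ := exists_dual_bPiece ℓ (dualAug 𝒜).toLinearMap (fun a ha => by
    induction ha using Submodule.span_induction with
    | zero => simp
    | add a b _ _ ha hb => rw [map_add, ha, hb, add_zero]
    | smul c a _ ha =>
      have : dualAug 𝒜 a = 0 := ha
      simp [this]
    | mem a ha =>
      obtain ⟨ξ, -, rfl⟩ := ha
      simp) 0
  exact ⟨φ, (hφ 1 (bOne 𝒜 ℓ).2).trans (by simp)⟩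

/-- `B₀` is spanned by the class of `1`, so `B₀*` is the line through `φ` and `A ⊗ B₀*` is a copy of
`A`. -/
theorem eq_evalTensor_tmul {φ : Module.Dual k (bPiece 𝒜 ℓ 0)} (hφ : φ (bOne 𝒜 ℓ) = 1)
    (z : A ⊗[k] Module.Dual k (bPiece 𝒜 ℓ 0)) : z = evalTensor (bOne 𝒜 ℓ) z ⊗ₜ[k] φ := by
  induction z with
  | zero => simp
  | add y z hy hz =>
    rw [map_add, TensorProduct.add_tmul, ← hy, ← hz]
  | tmul a ψ =>
    rw [evalTensor_tmul, TensorProduct.smul_tmul]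
    congr 1
    ext m
    obtain ⟨c, rfl⟩ := exists_smul_bOne ℓ m
    simp [hφ, mul_comm]

theorem evalTensor_bOne_injective : Function.Injective
    (evalTensor (k := k) (A := A) (bOne 𝒜 ℓ)) := by
  obtain ⟨φ₀, hφ₀⟩ := exists_dual_bOne ℓ
  intro y z h
  rw [eq_evalTensor_tmul ℓ hφ₀ y, h, ← eq_evalTensor_tmul ℓ hφ₀ z]

/-! ### Orbit maps of representations of `A^!`. -/

section Representation

variable {X : Type u} [AddCommGroup X] [Module k X] (ρ : QuadraticDual 𝒜 →ₐ[k] Module.End k X)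
  (u : X)

theorem rep_mul_apply (a b : QuadraticDual 𝒜) : ρ (a * b) u = ρ a (ρ b u) := by
  rw [map_mul, Module.End.mul_apply]

theorem rep_apply_eq_zero (h : ∀ ξ : Module.Dual k (𝒜 1), (∀ j, ξ (ℓ j) = 0) →
    ρ (dualGen 𝒜 ξ) u = 0) : ∀ a ∈ leftIdeal 𝒜 ℓ, ρ a u = 0 := by
  intro a ha
  induction ha using Submodule.span_induction with
  | zero => simp
  | add a b _ _ ha hb => rw [map_add, LinearMap.add_apply, ha, hb, add_zero]
  | smul c a _ ha => rw [smul_eq_mul, rep_mul_apply, ha, map_zero]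
  | mem a ha =>
    obtain ⟨ξ, hξ, rfl⟩ := ha
    exact h ξ hξ

theorem rep_apply_of_mem_dualPiece (π : ℕ → X →ₗ[k] QuadraticDual 𝒜 ⧸ leftIdeal 𝒜 ℓ)
    (h0 : π 0 u = (leftIdeal 𝒜 ℓ).mkQ 1)
    (hπ : ∀ j ξ y, π (j + 1) (ρ (dualGen 𝒜 ξ) y) = dualGen 𝒜 ξ • π j y) (j : ℕ) :
    ∀ a ∈ dualPiece 𝒜 j, π j (ρ a u) = (leftIdeal 𝒜 ℓ).mkQ a := by
  induction j with
  | zero =>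
    intro a ha
    rw [dualPiece, pow_zero, Submodule.mem_one] at ha
    obtain ⟨c, rfl⟩ := ha
    rw [AlgHom.commutes, Algebra.algebraMap_eq_smul_one, Algebra.algebraMap_eq_smul_one,
      LinearMap.smul_apply, map_smul, Module.End.one_apply, h0]
    rfl
  | succ j ih =>
    intro a ha
    rw [dualPiece, pow_succ'] at ha
    induction ha using Submodule.mul_induction_on' with
    | mem_mul_mem b hb c hc =>
      obtain ⟨ξ, rfl⟩ := hb
      rw [rep_mul_apply, hπ, ih c hc, ← map_smul, smul_eq_mul]
    | add b _ c _ hb hc =>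
      rw [map_add, map_add, LinearMap.add_apply, map_add, hb, hc]

end Representation

variable {n : ℕ} (x : Module.Basis (Fin n) k (𝒜 1))

set_option maxHeartbeats 1000000 in
/-- Functionals `ψⱼ` on `Bᵢ` come from a functional `φ` on `Bᵢ₊₁`, as `ψⱼ = φ · xⱼ*`, as soon as
this is compatible with the relations of `B`. -/
theorem exists_dual_bPiece_leftMul (i : ℕ) (ψ : Fin n → Module.Dual k (bPiece 𝒜 ℓ i))
    (h : ∀ f : ∀ j, bPiece 𝒜 ℓ j, ∑ j, ∑ l,
      ψ j (shiftMul (dualGen_smul_mem_bPiece 𝒜 ℓ) (x.coord l) f i) •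
        ((x j : A) * (x l : A)) = 0)
    (h' : ∀ ξ : Module.Dual k (𝒜 1), (∀ j, ξ (ℓ j) = 0) →
      ∑ j, ξ (x j) * ψ j ((Pi.single 0 (bOne 𝒜 ℓ) : ∀ j, bPiece 𝒜 ℓ j) i) = 0) :
    ∃ φ : Module.Dual k (bPiece 𝒜 ℓ (i + 1)), ∀ j m,
      φ (leftMul 𝒜 _ (dualGen_smul_mem_bPiece 𝒜 ℓ) i (x.coord j) m) = ψ j m := by
  obtain ⟨ρ, hρ⟩ : ∃ ρ : QuadraticDual 𝒜 →ₐ[k] Module.End k ((∀ j, bPiece 𝒜 ℓ j) × k),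
      ∀ ξ p, ρ (dualGen 𝒜 ξ) p =
        (shiftMul (dualGen_smul_mem_bPiece 𝒜 ℓ) ξ p.1, ∑ j, ξ (x j) * ψ j (p.1 i)) :=
    ⟨extRep (dualGen_smul_mem_bPiece 𝒜 ℓ) x i ψ h, fun ξ p => extRep_dualGen x i ψ h ξ p⟩
  -- The vector `1 ∈ B₀`; its scalar part does not matter, since the action ignores it.
  obtain ⟨u, hu⟩ : ∃ u : (∀ j, bPiece 𝒜 ℓ j) × k, u.1 = Pi.single 0 (bOne 𝒜 ℓ) :=
    ⟨(Pi.single 0 (bOne 𝒜 ℓ), 0), rfl⟩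
  -- The generators of `L` kill `u`: on sequences because they kill `1 ∈ B`, on the scalar by `h'`,
  -- which has content only for `i = 0`.
  have hL := rep_apply_eq_zero ℓ ρ u (fun ξ hξ => by
    rw [hρ, hu]
    refine Prod.ext (funext fun j => ?_) (h' ξ hξ)
    match j with
    | 0 => rfl
    | 1 =>
      exact leftMul_bOne_eq_zero ℓ hξ
    | j + 2 => simp)
  have hB := rep_apply_of_mem_dualPiece ℓ ρ u
    (fun j => (bPiece 𝒜 ℓ j).subtype ∘ₗ LinearMap.proj j ∘ₗ LinearMap.fst k _ _)
    (by simp [hu, bOne]) (fun j ξ y => by simp [hρ])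
  obtain ⟨f, hf⟩ : ∃ f : QuadraticDual 𝒜 →ₗ[k] k, ∀ a, f a = (ρ a u).2 :=
    ⟨LinearMap.snd k (∀ j, bPiece 𝒜 ℓ j) k ∘ₗ LinearMap.applyₗ u ∘ₗ ρ.toLinearMap, fun a => rfl⟩
  obtain ⟨φ, hφ⟩ := exists_dual_bPiece ℓ f (fun a ha => by rw [hf, hL a ha]; rfl) (i + 1)
  refine ⟨φ, fun j m => ?_⟩
  obtain ⟨a, ha, hm⟩ := m.2
  have e1 : (ρ a u).1 i = m := Subtype.ext ((hB i a ha).trans hm)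
  have e2 : (leftIdeal 𝒜 ℓ).mkQ (dualGen 𝒜 (x.coord j) * a) =
      leftMul 𝒜 _ (dualGen_smul_mem_bPiece 𝒜 ℓ) i (x.coord j) m := by
    rw [coe_leftMul, ← hm]
    rfl
  -- If `a` represents `m`, the value at `xⱼ* m` is the scalar part of `xⱼ* (a u)`; as `a u` has
  -- `i`-th entry `m`, this is `ψⱼ m`.
  have e3 := hφ _ (e2 ▸ SetLike.coe_mem _)
  rw [hf, rep_mul_apply, hρ, e1] at e3
  have e4 : leftMul 𝒜 _ (dualGen_smul_mem_bPiece 𝒜 ℓ) i (x.coord j) m =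
      ⟨_, e2 ▸ SetLike.coe_mem _⟩ := Subtype.ext e2.symm
  rw [e4, e3]
  simp [Finsupp.single_apply]

end LeftModule

/-! ### Ideals generated by linear forms -/

section LinearForms

variable {𝒜 : ℕ → Submodule k A} [GradedAlgebra 𝒜] {r : ℕ} (ℓ : Fin r → 𝒜 1)

/-- In degree one the ideal is just the `k`-span of the `ℓ j`, and a subspace is cut out by the
functionals vanishing on it. -/
theorem mem_linIdeal_iff (hA : IsStandardGraded 𝒜) (v : 𝒜 1) :
    (v : A) ∈ linIdeal 𝒜 ℓ ↔ ∀ ξ : Module.Dual k (𝒜 1), (∀ j, ξ (ℓ j) = 0) → ξ v = 0 := by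
  constructor
  · intro hv ξ hξ
    obtain ⟨c, hc⟩ := Ideal.mem_span_range_iff_exists_fun.1 hv
    have h1 : v ∈ Submodule.span k (Set.range ℓ) := by
      -- Only the degree zero parts of the coefficients contribute in degree one, and these are
      -- scalars as `A₀ = k`.
      have h2 : ∀ j, ∃ e : k, algebraMap k A e = (DirectSum.decompose 𝒜 (c j) 0 : A) := fun j =>
        hA.exists_algebraMap (SetLike.coe_mem _)
      choose e he using h2
      have h3 : v = ∑ j, e j • ℓ j := by
        ext
        rw [← DirectSum.decompose_of_mem_same 𝒜 v.2, ← hc, DirectSum.decompose_sum,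
          DFinsupp.finsetSum_apply, AddSubmonoidClass.coe_finsetSum,
          AddSubmonoidClass.coe_finsetSum]
        refine Finset.sum_congr rfl fun j _ => ?_
        rw [DirectSum.coe_decompose_mul_of_right_mem_of_le 𝒜 (ℓ j).2 le_rfl, Nat.sub_self, ← he,
          Submodule.coe_smul, Algebra.smul_def]
      rw [h3]
      exact sum_mem fun j _ => Submodule.smul_mem _ _ (Submodule.subset_span ⟨j, rfl⟩)
    have h4 : Submodule.span k (Set.range ℓ) ≤ LinearMap.ker ξ := by
      rw [Submodule.span_le]
      rintro _ ⟨j, rfl⟩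
      exact hξ j
    exact h4 h1
  · intro h
    have h1 : v ∈ Submodule.span k (Set.range ℓ) := by
      by_contra hv
      obtain ⟨ξ, hξ, hξ'⟩ := Submodule.exists_le_ker_of_notMem hv
      exact hξ (h ξ fun j => hξ' (Submodule.subset_span ⟨j, rfl⟩))
    have h2 : Submodule.span k (Set.range ℓ) ≤
        ((linIdeal 𝒜 ℓ).restrictScalars k).comap (𝒜 1).subtype := by
      rw [Submodule.span_le]
      rintro _ ⟨j, rfl⟩
      exact Ideal.subset_span ⟨j, rfl⟩
    exact h2 h1

theorem isHomogeneous_linIdeal : (linIdeal 𝒜 ℓ).IsHomogeneous 𝒜 :=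
  Ideal.homogeneous_span 𝒜 _ (by
    rintro _ ⟨j, rfl⟩
    exact ⟨1, (ℓ j).2⟩)

theorem linIdeal_le_irrelevant :
    linIdeal 𝒜 ℓ ≤ (HomogeneousIdeal.irrelevant 𝒜).toIdeal := by
  refine Ideal.span_le.2 ?_
  rintro _ ⟨j, rfl⟩
  refine (HomogeneousIdeal.mem_irrelevant_iff 𝒜 _).2 ?_
  rw [GradedRing.proj_apply, DirectSum.decompose_of_mem_ne 𝒜 (ℓ j).2 one_ne_zero]

theorem exists_proj_quotientGrading (J : Ideal A) (hJ : J.IsHomogeneous 𝒜) (n : ℕ) :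
    ∃ p : A ⧸ J →+ A ⧸ J, (∀ y ∈ quotientGrading 𝒜 J n, p y = y) ∧
      ∀ m, m ≠ n → ∀ y ∈ quotientGrading 𝒜 J m, p y = 0 := by
  let p : A ⧸ J →+ A ⧸ J := QuotientAddGroup.map J.toAddSubgroup J.toAddSubgroup
    (GradedRing.proj 𝒜 n) fun a ha => hJ n ha
  have hp : ∀ a, p (J.mkQ a) = J.mkQ (GradedRing.proj 𝒜 n a) := fun a => rfl
  refine ⟨p, ?_, ?_⟩
  · rintro _ ⟨a, ha, rfl⟩
    refine (hp a).trans ?_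
    rw [GradedRing.proj_apply, DirectSum.decompose_of_mem_same 𝒜 ha]
    rfl
  · rintro m hm _ ⟨a, ha, rfl⟩
    refine (hp a).trans ?_
    rw [GradedRing.proj_apply, DirectSum.decompose_of_mem_ne 𝒜 ha hm, map_zero]

theorem exists_proj_idealGrading (J : Ideal A) (hJ : J.IsHomogeneous 𝒜) (n : ℕ) :
    ∃ p : J →+ J, (∀ y ∈ idealGrading 𝒜 J n, p y = y) ∧
      ∀ m, m ≠ n → ∀ y ∈ idealGrading 𝒜 J m, p y = 0 := by
  let p : J →+ J := ((GradedRing.proj 𝒜 n).comp J.subtype.toAddMonoidHom).codRestrict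
    J.toAddSubgroup fun a => hJ n a.2
  have hp : ∀ a, (p a : A) = GradedRing.proj 𝒜 n a := fun a => rfl
  refine ⟨p, fun y hy => Subtype.ext ?_, fun m hm y hy => Subtype.ext ?_⟩
  · rw [hp, GradedRing.proj_apply, DirectSum.decompose_of_mem_same 𝒜 (show (y : A) ∈ 𝒜 n from hy)]
  · rw [hp, GradedRing.proj_apply, DirectSum.decompose_of_mem_ne 𝒜 (show (y : A) ∈ 𝒜 m from hy) hm]
    rfl

end LinearForms

/-! ### The complex `A ⊗ B*` -/

section SubPriddy

variable {𝒜 : ℕ → Submodule k A} [GradedAlgebra 𝒜] {r : ℕ} (ℓ : Fin r → 𝒜 1) {n : ℕ}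
  (x : Module.Basis (Fin n) k (𝒜 1))

/-- The linear form `∑ φ(xⱼ* · 1) xⱼ` is killed by every `ξ` vanishing on the `ℓ j`, because `ξ · 1
= 0` in `B`. -/
theorem evalTensor_traceMul_mem (hA : IsStandardGraded 𝒜)
    (z : A ⊗[k] Module.Dual k (bPiece 𝒜 ℓ 1)) :
    evalTensor (bOne 𝒜 ℓ) (traceMul 𝒜 _ (dualGen_smul_mem_bPiece 𝒜 ℓ) x 0 z) ∈
      linIdeal 𝒜 ℓ := by
  induction z with
  | zero => simp
  | add y z hy hz =>
    rw [map_add, map_add]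
    exact add_mem hy hz
  | tmul a φ =>
    rw [evalTensor_traceMul_tmul]
    refine Ideal.mul_mem_right _ _ ?_
    have h := (mem_linIdeal_iff ℓ hA (∑ j, φ (leftMul 𝒜 _ (dualGen_smul_mem_bPiece 𝒜 ℓ) 0
      (x.coord j) (bOne 𝒜 ℓ)) • x j)).2 fun ξ hξ => by
        have h1 := congrArg φ (leftMul_eq_sum (hN := dualGen_smul_mem_bPiece 𝒜 ℓ) x 0 ξ
          (bOne 𝒜 ℓ))
        rw [leftMul_bOne_eq_zero ℓ hξ, map_zero, map_sum] at h1
        rw [map_sum, h1]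
        exact Finset.sum_congr rfl fun j _ => by
          rw [map_smul, map_smul, smul_eq_mul, smul_eq_mul, mul_comm]
    rw [AddSubmonoidClass.coe_finsetSum] at h
    simpa only [Submodule.coe_smul] using h

-- One needs `φ ∈ B₁*` whose values on `xⱼ* · 1` are the coordinates of `v`. The quadratic condition
-- is empty for `i = 0`, and the condition from `L` says that `ξ v = 0` whenever `ξ` vanishes on the
-- `ℓ j`.
set_option maxHeartbeats 1000000 in
theorem exists_evalTensor_traceMul_eq (hA : IsStandardGraded 𝒜) (v : 𝒜 1)
    (hv : (v : A) ∈ linIdeal 𝒜 ℓ) : ∃ φ : Module.Dual k (bPiece 𝒜 ℓ 1),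
      evalTensor (bOne 𝒜 ℓ)
        (traceMul 𝒜 _ (dualGen_smul_mem_bPiece 𝒜 ℓ) x 0 ((1 : A) ⊗ₜ[k] φ)) = v := by
  obtain ⟨φ₀, hφ₀⟩ := exists_dual_bOne ℓ
  obtain ⟨φ, hφ⟩ := exists_dual_bPiece_leftMul ℓ x 0 (fun j => x.repr v j • φ₀)
    (fun f => by simp) (fun ξ hξ => by
      have h := (mem_linIdeal_iff ℓ hA v).1 hv ξ hξ
      rw [← x.sum_repr v, map_sum] at h
      rw [← h]
      exact Finset.sum_congr rfl fun j _ => by simp [hφ₀, mul_comm])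
  refine ⟨φ, ?_⟩
  rw [evalTensor_traceMul_tmul, mul_one]
  have h := congrArg Subtype.val (x.sum_repr v)
  rw [AddSubmonoidClass.coe_finsetSum] at h
  rw [← h]
  exact Finset.sum_congr rfl fun j _ => by simp [hφ, hφ₀]

theorem evalTensor_mem_linIdeal_iff (hA : IsStandardGraded 𝒜)
    (z : A ⊗[k] Module.Dual k (bPiece 𝒜 ℓ 0)) :
    evalTensor (bOne 𝒜 ℓ) z ∈ linIdeal 𝒜 ℓ ↔
      z ∈ LinearMap.range (traceMul 𝒜 _ (dualGen_smul_mem_bPiece 𝒜 ℓ) x 0) := by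
  constructor
  · intro hz
    have h : linIdeal 𝒜 ℓ ≤ (LinearMap.range (evalTensor (k := k) (A := A) (bOne 𝒜 ℓ) ∘ₗ
        traceMul 𝒜 _ (dualGen_smul_mem_bPiece 𝒜 ℓ) x 0)) := by
      refine Ideal.span_le.2 ?_
      rintro _ ⟨j, rfl⟩
      obtain ⟨φ, hφ⟩ := exists_evalTensor_traceMul_eq ℓ x hA (ℓ j) (Ideal.subset_span ⟨j, rfl⟩)
      exact ⟨_, hφ⟩
    obtain ⟨w, hw⟩ := h hz
    exact ⟨w, evalTensor_bOne_injective ℓ hw⟩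
  · rintro ⟨w, rfl⟩
    exact evalTensor_traceMul_mem ℓ x hA w

-- One degree above the generators a cycle is `∑ xⱼ ⊗ ψⱼ`. Evaluated at elements of `Bᵢ`, the cycle
-- condition is exactly the quadratic compatibility needed to find `φ` with `φ · xⱼ* = ψⱼ`; then `1
-- ⊗ φ` maps to the cycle.
set_option maxHeartbeats 1000000 in
theorem mem_range_traceMul (i : ℕ) {l : ℕ} (hl : l = i + 1 + 1)
    {z : A ⊗[k] Module.Dual k (bPiece 𝒜 ℓ (i + 1))}
    (hz : z ∈ (subPriddyComplex 𝒜 x ℓ).gr (i + 1) l)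
    (h : traceMul 𝒜 _ (dualGen_smul_mem_bPiece 𝒜 ℓ) x i z = 0) :
    z ∈ LinearMap.range (traceMul 𝒜 _ (dualGen_smul_mem_bPiece 𝒜 ℓ) x (i + 1)) := by
  obtain ⟨ψ, rfl⟩ := exists_eq_sum_tmul x hl hz
  obtain ⟨φ, hφ⟩ := exists_dual_bPiece_leftMul ℓ x (i + 1) ψ (fun f => by
    have h1 := congrArg (evalTensor (f i)) h
    rw [map_zero, map_sum, map_sum] at h1
    refine Eq.trans (Finset.sum_congr rfl fun j _ => ?_) h1
    rw [evalTensor_traceMul_tmul, Finset.sum_mul]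
    exact Finset.sum_congr rfl fun l _ => by
      rw [shiftMul_succ, smul_mul_assoc, mul_comm]) (fun ξ _ => by simp)
  refine ⟨1 ⊗ₜ[k] φ, ?_⟩
  rw [traceMul_tmul]
  refine Finset.sum_congr rfl fun j _ => ?_
  rw [mul_one, show rightMul 𝒜 _ (dualGen_smul_mem_bPiece 𝒜 ℓ) (i + 1) (x.coord j) φ = ψ j from
    LinearMap.ext fun m => hφ j m]

theorem evalTensor_mem_of_mem_gr {l : ℕ} {z : A ⊗[k] Module.Dual k (bPiece 𝒜 ℓ 0)}
    (hz : z ∈ (subPriddyComplex 𝒜 x ℓ).gr 0 l) : evalTensor (bOne 𝒜 ℓ) z ∈ 𝒜 l := by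
  induction hz using AddSubgroup.closure_induction with
  | zero => simp
  | add y z _ _ hy hz =>
    have := add_mem hy hz
    rwa [← map_add] at this
  | neg y _ hy =>
    have := neg_mem hy
    rwa [← map_neg] at this
  | mem y hy =>
    obtain ⟨m, rfl, a, ha, φ, rfl⟩ := hy
    rw [evalTensor_tmul]
    exact Submodule.smul_mem _ _ ha

theorem subPriddyAug_apply (z : A ⊗[k] Module.Dual k (bPiece 𝒜 ℓ 0)) :
    subPriddyAug 𝒜 x ℓ z = (linIdeal 𝒜 ℓ).mkQ (evalTensor (bOne 𝒜 ℓ) z) := rfl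

theorem subPriddyAug_eq_zero_iff (hA : IsStandardGraded 𝒜)
    (z : A ⊗[k] Module.Dual k (bPiece 𝒜 ℓ 0)) : subPriddyAug 𝒜 x ℓ z = 0 ↔
      z ∈ LinearMap.range (traceMul 𝒜 _ (dualGen_smul_mem_bPiece 𝒜 ℓ) x 0) := by
  rw [← evalTensor_mem_linIdeal_iff ℓ x hA]
  exact Submodule.Quotient.mk_eq_zero _

theorem subPriddy_free (i : ℕ) : ∃ (s : ℕ)
    (b : Module.Basis (Fin s) A ((subPriddyComplex 𝒜 x ℓ).X i)),
      IsHomogeneousBasis 𝒜 ((subPriddyComplex 𝒜 x ℓ).gr i) b fun _ => i := by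
  have := Module.Finite.of_basis x
  have := finite_bPiece ℓ i
  exact exists_basis_dualComplex x i

theorem subPriddy_injOn (hA : IsStandardGraded 𝒜) (i : ℕ) {l : ℕ} (hl : l = i + 1)
    {z : A ⊗[k] Module.Dual k (bPiece 𝒜 ℓ (i + 1))}
    (hz : z ∈ (subPriddyComplex 𝒜 x ℓ).gr (i + 1) l)
    (h : traceMul 𝒜 _ (dualGen_smul_mem_bPiece 𝒜 ℓ) x i z = 0) : z = 0 := by
  subst hl
  exact traceMul_injOn x hA i (dual_bPiece_eq_zero ℓ i) hz h

theorem isLinearStrandOf_subPriddy (hA : IsStandardGraded 𝒜) :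
    (subPriddyComplex 𝒜 x ℓ).IsLinearStrandOf 𝒜 (quotientGrading 𝒜 (linIdeal 𝒜 ℓ)) 0
      (subPriddyAug 𝒜 x ℓ) where
  free i := by
    simp only [zero_add]
    exact subPriddy_free ℓ x i
  aug_mem y hy := ⟨_, evalTensor_mem_of_mem_gr ℓ x hy, rfl⟩
  aug_inj y hy h := by
    refine evalTensor_bOne_injective ℓ (Eq.trans ?_ (map_zero _).symm)
    -- The value has degree zero and lies in `(ℓ) ⊆ A₊`, so it vanishes.
    have h0 : evalTensor (bOne 𝒜 ℓ) y ∈ linIdeal 𝒜 ℓ :=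
      (evalTensor_mem_linIdeal_iff ℓ x hA y).2 ((subPriddyAug_eq_zero_iff ℓ x hA y).1 h)
    have h1 := (HomogeneousIdeal.mem_irrelevant_iff 𝒜 _).1 (linIdeal_le_irrelevant ℓ h0)
    rwa [GradedRing.proj_apply,
      DirectSum.decompose_of_mem_same 𝒜 (evalTensor_mem_of_mem_gr ℓ x hy)] at h1
  aug_surj := by
    rintro _ ⟨a, ha, rfl⟩
    obtain ⟨φ₀, hφ₀⟩ := exists_dual_bOne ℓ
    refine ⟨a ⊗ₜ[k] φ₀, tmul_mem_gr x rfl ha φ₀, ?_⟩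
    refine (subPriddyAug_apply ℓ x _).trans ?_
    rw [evalTensor_tmul, hφ₀, one_smul]
    rfl
  aug_exact z _ := subPriddyAug_eq_zero_iff ℓ x hA z
  inj i y hy h := subPriddy_injOn ℓ x hA i (zero_add _) hy h
  exact i z hz h := mem_range_traceMul ℓ x i (by omega) hz h

/-- The augmentation `A ⊗ B₁* → (ℓ)`. -/
def tailAug (hA : IsStandardGraded 𝒜) :
    (subPriddyComplex 𝒜 x ℓ).tail.X 0 →ₗ[A] linIdeal 𝒜 ℓ :=
  (evalTensor (bOne 𝒜 ℓ) ∘ₗ traceMul 𝒜 _ (dualGen_smul_mem_bPiece 𝒜 ℓ) x 0).codRestrict _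
    (evalTensor_traceMul_mem ℓ x hA)

theorem tailAug_eq_zero_iff (hA : IsStandardGraded 𝒜)
    (z : A ⊗[k] Module.Dual k (bPiece 𝒜 ℓ 1)) : tailAug ℓ x hA z = 0 ↔
      traceMul 𝒜 _ (dualGen_smul_mem_bPiece 𝒜 ℓ) x 0 z = 0 :=
  ⟨fun h => evalTensor_bOne_injective ℓ ((congrArg Subtype.val h).trans (map_zero _).symm),
    fun h => Subtype.ext ((congrArg (evalTensor (bOne 𝒜 ℓ)) h).trans (map_zero _))⟩

theorem isLinearStrandOf_tail (hA : IsStandardGraded 𝒜) :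
    (subPriddyComplex 𝒜 x ℓ).tail.IsLinearStrandOf 𝒜 (idealGrading 𝒜 (linIdeal 𝒜 ℓ)) 1
      (tailAug ℓ x hA) where
  free i := by
    rw [add_comm 1 i]
    exact subPriddy_free ℓ x (i + 1)
  aug_mem y hy := evalTensor_mem_of_mem_gr ℓ x ((subPriddyComplex 𝒜 x ℓ).d_mem 0 1 y hy)
  aug_inj y hy h := subPriddy_injOn ℓ x hA 0 rfl hy ((tailAug_eq_zero_iff ℓ x hA y).1 h)
  aug_surj := by
    rintro ⟨v, hv⟩ hv'
    obtain ⟨φ, hφ⟩ := exists_evalTensor_traceMul_eq ℓ x hA ⟨v, hv'⟩ hv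
    exact ⟨1 ⊗ₜ[k] φ, tmul_mem_gr (hN := dualGen_smul_mem_bPiece 𝒜 ℓ) x (zero_add 1) SetLike.GradedOne.one_mem φ, Subtype.ext hφ⟩
  aug_exact z hz := by
    refine (tailAug_eq_zero_iff ℓ x hA z).trans ⟨mem_range_traceMul ℓ x 0 rfl hz, ?_⟩
    rintro ⟨w, rfl⟩
    exact LinearMap.congr_fun ((subPriddyComplex 𝒜 x ℓ).d_comp_d 0) w
  inj i y hy h := subPriddy_injOn ℓ x hA (i + 1) (by omega) hy h
  exact i z hz h := mem_range_traceMul ℓ x (i + 1) (by omega) hz h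

theorem idealGrading_eq_zero_of_lt_one (J : Ideal A)
    (hJ : J ≤ (HomogeneousIdeal.irrelevant 𝒜).toIdeal) :
    ∀ m < 1, ∀ y ∈ idealGrading 𝒜 J m, y = 0 := by
  intro m hm y hy
  obtain rfl : m = 0 := by omega
  have h := (HomogeneousIdeal.mem_irrelevant_iff 𝒜 _).1 (hJ y.2)
  rw [GradedRing.proj_apply,
    DirectSum.decompose_of_mem_same 𝒜 (show (y : A) ∈ 𝒜 0 from hy)] at h
  exact Subtype.ext h

/-- If the ideal `(ℓ)` has a linear resolution, then `A ⊗ B*` is exact in positive degrees. -/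
theorem subPriddy_exact_succ [Nontrivial A] (hA : IsStandardGraded 𝒜)
    (h : HasLinearResolution 𝒜 (idealGrading 𝒜 (linIdeal 𝒜 ℓ)) 1) (i : ℕ) :
    Function.Exact ((subPriddyComplex 𝒜 x ℓ).d (i + 1)) ((subPriddyComplex 𝒜 x ℓ).d i) := by
  obtain ⟨F, ε, hF, hlin⟩ := h
  obtain ⟨e, he, hε, hcomm⟩ := (isLinearStrandOf_tail ℓ x hA).exists_comparison hA hF
    (idealGrading_eq_zero_of_lt_one _ (linIdeal_le_irrelevant ℓ)) (exists_proj_idealGrading _ (isHomogeneous_linIdeal ℓ) 1)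
  have key : ∀ j z, e j z ∈ LinearMap.range (F.d j) →
      z ∈ LinearMap.range ((subPriddyComplex 𝒜 x ℓ).d (j + 1)) := by
    rintro j z ⟨w, hw⟩
    -- Linearity of the resolution enters here: the strand is all of `F`, so `e (j + 1)` is
    -- surjective.
    have hw' : w ∈ LinearMap.range (e (j + 1)) := by
      rw [(he (j + 1)).range_eq, hlin]
      trivial
    obtain ⟨y, rfl⟩ := hw'
    exact ⟨y, (he j).injective ((hcomm j y).trans hw)⟩
  intro z
  constructor
  · intro hz
    cases i with
    | zero =>
      refine key 0 z ((hF.exact_zero _).1 ?_)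
      exact (LinearMap.congr_fun hε z).trans ((tailAug_eq_zero_iff ℓ x hA z).2 hz)
    | succ i =>
      refine key (i + 1) z ((hF.exact_succ i _).1 ?_)
      exact (hcomm i z).symm.trans ((congrArg (e i) hz).trans (map_zero _))
  · rintro ⟨w, rfl⟩
    exact LinearMap.congr_fun ((subPriddyComplex 𝒜 x ℓ).d_comp_d i) w

theorem subPriddy_isMinimal : (subPriddyComplex 𝒜 x ℓ).IsMinimal 𝒜 := by
  rintro i _ ⟨z, rfl⟩
  exact traceMul_mem_irrelevant_smul x i z

theorem subPriddy_isMinimalFreeResolution [Nontrivial A] (hA : IsStandardGraded 𝒜)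
    (h : HasLinearResolution 𝒜 (idealGrading 𝒜 (linIdeal 𝒜 ℓ)) 1) :
    (subPriddyComplex 𝒜 x ℓ).IsMinimalFreeResolution 𝒜 (quotientGrading 𝒜 (linIdeal 𝒜 ℓ))
      (subPriddyAug 𝒜 x ℓ) where
  free i := by
    obtain ⟨s, b, hb⟩ := subPriddy_free ℓ x i
    exact ⟨s, b, _, hb⟩
  minimal := subPriddy_isMinimal ℓ x
  graded m y hy := ⟨_, evalTensor_mem_of_mem_gr ℓ x hy, rfl⟩
  surjective y := by
    obtain ⟨a, rfl⟩ := Submodule.mkQ_surjective _ y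
    obtain ⟨φ₀, hφ₀⟩ := exists_dual_bOne ℓ
    refine ⟨a ⊗ₜ[k] φ₀, (subPriddyAug_apply ℓ x _).trans ?_⟩
    rw [evalTensor_tmul, hφ₀, one_smul]
  exact_zero z := subPriddyAug_eq_zero_iff ℓ x hA z
  exact_succ := subPriddy_exact_succ ℓ x hA h

/-! ### The inclusion into the Priddy complex -/

/-- The dual of the surjection `A^!ᵢ → Bᵢ` is injective, and `A` is flat over the field `k`. -/
theorem subPriddyInclusion_injective (i : ℕ) :
    Function.Injective (subPriddyInclusion 𝒜 x ℓ i) := by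
  have h : Function.Injective (((leftIdeal 𝒜 ℓ).mkQ.restrictScalars k).submoduleMap
      (dualPiece 𝒜 i)).dualMap :=
    LinearMap.dualMap_injective_of_surjective (LinearMap.submoduleMap_surjective _ _)
  exact Module.Flat.lTensor_preserves_injective_linearMap (M := A) _ h

theorem subPriddyInclusion_mem (i m : ℕ) : ∀ y ∈ (subPriddyComplex 𝒜 x ℓ).gr i m,
    subPriddyInclusion 𝒜 x ℓ i y ∈ (priddyComplex 𝒜 x).gr i m := by
  have h : (subPriddyComplex 𝒜 x ℓ).gr i m ≤ ((priddyComplex 𝒜 x).gr i m).comap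
      (subPriddyInclusion 𝒜 x ℓ i).toAddMonoidHom := by
    refine (AddSubgroup.closure_le _).2 ?_
    rintro _ ⟨l, hl, a, ha, φ, rfl⟩
    exact tmul_mem_gr (hN := dualGen_mul_mem 𝒜) x hl ha _
  exact fun y hy => h hy

theorem subPriddyInclusion_comm (i : ℕ) (y : (subPriddyComplex 𝒜 x ℓ).X (i + 1)) :
    subPriddyInclusion 𝒜 x ℓ i ((subPriddyComplex 𝒜 x ℓ).d i y) =
      (priddyComplex 𝒜 x).d i (subPriddyInclusion 𝒜 x ℓ (i + 1) y) :=
  map_dualMap_traceMul (hN := dualGen_mul_mem 𝒜) (hN' := dualGen_smul_mem_bPiece 𝒜 ℓ) x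
    (fun i => ((leftIdeal 𝒜 ℓ).mkQ.restrictScalars k).submoduleMap (dualPiece 𝒜 i))
    (fun _ _ _ => rfl) i y

end SubPriddy

end KoszulStrand

end

theorem mainTheorem3 {k A : Type u} [Field k] [CommRing A] [Nontrivial A] [Algebra k A]
    (𝒜 : ℕ → Submodule k A) [GradedAlgebra 𝒜] (hA : KoszulStrand.IsStandardGraded 𝒜)
    (hK : KoszulStrand.IsKoszul 𝒜) {n : ℕ} (x : Module.Basis (Fin n) k (𝒜 1))
    {r : ℕ} (ℓ : Fin r → 𝒜 1) :
    -- `A ⊗ B*` is a subcomplex of the Priddy complex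
    ((∀ i, Function.Injective (KoszulStrand.subPriddyInclusion 𝒜 x ℓ i)) ∧
      (∀ i m, ∀ y ∈ (KoszulStrand.subPriddyComplex 𝒜 x ℓ).gr i m,
        KoszulStrand.subPriddyInclusion 𝒜 x ℓ i y ∈ (KoszulStrand.priddyComplex 𝒜 x).gr i m) ∧
      (∀ i y, KoszulStrand.subPriddyInclusion 𝒜 x ℓ i
          ((KoszulStrand.subPriddyComplex 𝒜 x ℓ).d i y) =
        (KoszulStrand.priddyComplex 𝒜 x).d i
          (KoszulStrand.subPriddyInclusion 𝒜 x ℓ (i + 1) y))) ∧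
    -- it is the linear strand of the minimal graded free resolution of `A / (ℓ)`
    (∀ (F : KoszulStrand.GradedComplex A) (ε : F.X 0 →ₗ[A] A ⧸ KoszulStrand.linIdeal 𝒜 ℓ)
      (hF : F.IsMinimalFreeResolution 𝒜
        (KoszulStrand.quotientGrading 𝒜 (KoszulStrand.linIdeal 𝒜 ℓ)) ε),
      Nonempty ((F.linearStrand hA hF.free hF.minimal 0).GradedIso
        (KoszulStrand.subPriddyComplex 𝒜 x ℓ))) ∧
    -- its part in homological degrees `≥ 1` is the linear strand of the ideal `(ℓ)` itself
    (∀ (F : KoszulStrand.GradedComplex A) (ε : F.X 0 →ₗ[A] KoszulStrand.linIdeal 𝒜 ℓ)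
      (hF : F.IsMinimalFreeResolution 𝒜
        (KoszulStrand.idealGrading 𝒜 (KoszulStrand.linIdeal 𝒜 ℓ)) ε),
      Nonempty ((F.linearStrand hA hF.free hF.minimal 1).GradedIso
        (KoszulStrand.subPriddyComplex 𝒜 x ℓ).tail)) ∧
    -- over a universally Koszul algebra it is the minimal graded free resolution of `A / (ℓ)`
    (KoszulStrand.IsUniversallyKoszul 𝒜 →
      (KoszulStrand.subPriddyComplex 𝒜 x ℓ).IsMinimalFreeResolution 𝒜
        (KoszulStrand.quotientGrading 𝒜 (KoszulStrand.linIdeal 𝒜 ℓ))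
        (KoszulStrand.subPriddyAug 𝒜 x ℓ)) := by
  open KoszulStrand in
  refine ⟨⟨subPriddyInclusion_injective ℓ x, subPriddyInclusion_mem ℓ x,
    subPriddyInclusion_comm ℓ x⟩, fun F ε hF => ?_, fun F ε hF => ?_, fun hU => ?_⟩
  · exact (isLinearStrandOf_subPriddy ℓ x hA).nonempty_gradedIso hA hF (by simp)
      (exists_proj_quotientGrading _ (isHomogeneous_linIdeal ℓ) 0)
  · exact (isLinearStrandOf_tail ℓ x hA).nonempty_gradedIso hA hF
      (idealGrading_eq_zero_of_lt_one _ (linIdeal_le_irrelevant ℓ))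
      (exists_proj_idealGrading _ (isHomogeneous_linIdeal ℓ) 1)
  · refine subPriddy_isMinimalFreeResolution ℓ x hA (hU.2 _ ?_)
    rintro _ ⟨j, rfl⟩
    exact (ℓ j).2
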